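/- Let $d,K,p$ be nonnegative integers with $K\ge 2$, let $a_1,\dots,a_K\in\mathbb R^d$ be deterministic, let $\Sigma$ be a symmetric positive semidefinite $d\times d$ matrix, and let $\xi_1,\dots,\xi_K$ be i.i.d. $\mathcal N(0,\Sigma)$ random vectors in $\mathbb R^d$. Put $\Delta\xi_k=\xi_k-K^{-1}\sum_{j=1}^K\xi_j$ and $$C=\frac1{K-1}\sum_{k=1}^K a_k\otimes a_k,\qquad D=C+\Sigma,\qquad Z=\frac1{K-1}\sum_{k=1}^K(a_k+\Delta\xi_k)\otimes(a_k+\Delta\xi_k).$$ For $\rho>0$ let $\mathcal C=\|C+\rho I_d\|\,\|(C+\rho I_d)^{-1}\|$ be the condition number of $C+\rho I_d$, where $\|\cdot\|$ is the $l_2$ operator norm, and, with $\preceq$ the Loewner order on symmetric matrices (and $\log 0:=0$ in the degenerate case $d=0$), let $$\mu=\inf\{r\ge0:[Z+\rho I_d]^{-1}\preceq r[D+\rho I_d]^{-1}\},\qquad \lambda=\inf\{r\ge0:Z\preceq r[D+\rho I_d]\}.$$ Assume $\operatorname{rank}([a_1,\dots,a_K])\le p$ and $\operatorname{rank}(\Sigma)\le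 p$. Then there are constants $C_n>0$ depending only on $n\in\{0,1,2,\dots\}$ and, for every $\delta>0$, constants $D_\delta,c_\delta>0$ depending only on $\delta$, such that for all such $d,K,p,(a_k),\Sigma,\rho,(\xi_k)$ the following holds. 1. $Z$ is integrable and $\mathbb E Z=D$. 2. If $K>\frac{D_\delta}{c_\delta}\,p$, then the event $\mathcal U=\{\lambda>1+5\delta\ \text{or}\ \mu>1+5\delta\}$ satisfies $$\mathbb P(\mathcal U)\le(\log\mathcal C+1)\exp(D_\delta p-c_\delta K).$$ 3. If $K>\frac{D_\delta}{c_\delta}\,p$ and $\rho\le\|\Sigma\|$, then for every $n\in\{0,1,2,\dots\}$ $$\mathbb E\big[\mathbf 1_{\mathcal U}\,\mu^n\big]\le C_n\,\rho^{-n}\|\Sigma\|^n(\log\mathcal C+1)\exp(D_\delta p-c_\delta K).$$ 4. If $K\ge D_\delta p$, then for every $t>0$ $$\mathbb P(\lambda>8+t)\le\exp(-c_\delta K t).$$ -/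

import Mathlib

open MeasureTheory ProbabilityTheory

namespace NoncentralCov

/-- The Loewner order `A ⪯ B` on real square matrices: `B - A` is (symmetric) positive
semidefinite. -/
def Loewner {d : ℕ} (A B : Matrix (Fin d) (Fin d) ℝ) : Prop :=
  (B - A).PosSemidef

/-- The `l²` operator norm of a real square matrix. -/
noncomputable def opNorm {d : ℕ} (A : Matrix (Fin d) (Fin d) ℝ) : ℝ :=
  ‖Matrix.toEuclideanCLM (n := Fin d) (𝕜 := ℝ) A‖

/-- The condition number `‖A‖ ‖A⁻¹‖` of an invertible matrix, in the `l²` operator norm. -/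
noncomputable def condNumber {d : ℕ} (A : Matrix (Fin d) (Fin d) ℝ) : ℝ :=
  opNorm A * opNorm A⁻¹

/-- `(K - 1)⁻¹ ∑ₖ xₖ ⊗ xₖ`. -/
noncomputable def sampleCov {d K : ℕ} (x : Fin K → EuclideanSpace ℝ (Fin d)) :
    Matrix (Fin d) (Fin d) ℝ :=
  ((K : ℝ) - 1)⁻¹ • ∑ k, Matrix.vecMulVec (x k).ofLp (x k).ofLp

/-- The deviations `Δxₖ = xₖ - K⁻¹ ∑ⱼ xⱼ` of an ensemble from its average. -/
noncomputable def deviation {d K : ℕ} (x : Fin K → EuclideanSpace ℝ (Fin d)) (k : Fin K) :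
    EuclideanSpace ℝ (Fin d) :=
  x k - (K : ℝ)⁻¹ • ∑ j, x j

/-- The matrix `Z = (K - 1)⁻¹ ∑ₖ (aₖ + Δξₖ) ⊗ (aₖ + Δξₖ)`, as a function of the values of the
vectors `ξₖ`. -/
noncomputable def noncentralCov {d K : ℕ} (a ξ : Fin K → EuclideanSpace ℝ (Fin d)) :
    Matrix (Fin d) (Fin d) ℝ :=
  sampleCov fun k => a k + deviation ξ k

/-- `λ = inf {r ≥ 0 : Z ⪯ r (D + ρ I)}`. -/
noncomputable def upperRatio {d : ℕ} (ρ : ℝ) (D Z : Matrix (Fin d) (Fin d) ℝ) : ℝ :=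
  sInf {r : ℝ | 0 ≤ r ∧ Loewner Z (r • (D + ρ • (1 : Matrix (Fin d) (Fin d) ℝ)))}

/-- `μ = inf {r ≥ 0 : (Z + ρ I)⁻¹ ⪯ r (D + ρ I)⁻¹}`. -/
noncomputable def inverseRatio {d : ℕ} (ρ : ℝ) (D Z : Matrix (Fin d) (Fin d) ℝ) : ℝ :=
  sInf {r : ℝ | 0 ≤ r ∧ Loewner (Z + ρ • (1 : Matrix (Fin d) (Fin d) ℝ))⁻¹
    (r • (D + ρ • (1 : Matrix (Fin d) (Fin d) ℝ))⁻¹)}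

/-- The event `λ > 1 + 5δ` or `μ > 1 + 5δ`, where `a`, `S` are the deterministic vectors and the
noise covariance, and `ξ` the random noise vectors. -/
def rareEvent {Ω : Type*} {d K : ℕ} (δ ρ : ℝ) (a : Fin K → EuclideanSpace ℝ (Fin d))
    (S : Matrix (Fin d) (Fin d) ℝ) (ξ : Fin K → Ω → EuclideanSpace ℝ (Fin d)) : Set Ω :=
  {ω | 1 + 5 * δ < upperRatio ρ (sampleCov a + S) (noncentralCov a fun k => ξ k ω) ∨
    1 + 5 * δ < inverseRatio ρ (sampleCov a + S) (noncentralCov a fun k => ξ k ω)}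

end NoncentralCov

/-! Fix a direction `x`, and put `y k = x ⬝ᵥ a k`, `e k = x ⬝ᵥ ξ k`. The `e k` are independent
centred normals of variance `xᵀ S x`, and `(K - 1) xᵀ Z x = ∑ (y k + e k - ē)²`. Expanding the
square leaves a constant, a linear form in `e`, the sum of the `e k ^ 2` and the square of the mean.
Chernoff bounds for these terms give `xᵀ Z x = (1 ± ε) xᵀ D x` outside an event of probability `6
exp (-ε² (K - 1) / 144)` (`shifted_sample_concentration`).

To make this uniform in `x`, write `xᵀ D x = ‖L x‖ ^ 2` with `rank L = rank D ≤ 2 p`. The unit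
sphere of this seminorm has a net of at most `(3 / ε) ^ (2 p)` points, whatever `d` is. Null vectors
of `D` are almost surely null vectors of `Z`, so a union bound over the net extends to all `x`
(`uniform_concentration`). The resulting two-sided comparison of `Z` with `D` implies `λ, μ ≤ 1 + 5
δ` deterministically, by antitonicity of inversion (`rareEvent_subset`). No scale-by-scale argument
is made, so `log 𝒞 + 1` enters only through being at least `1`.

The tail of `λ` comes from the same scheme with the cruder estimate `(y + e)² ≤ 2 y² + 2 e²`
(`uniform_upper_tail`).

For the moments, `a² ≤ 2 (a + e)² + 2 e²` bounds the signal by the sample and the noise. A noise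
covariance at most `q ‖Σ‖ I` thus gives `μ ≤ (2 q + 2) ‖Σ‖ / ρ`. The upper tail with `a = 0`
controls `q`, and a sum over layers of `q` gives the moments (`moment_bound`). -/

namespace NoncentralCov

/-! ### Nets of spheres, from volume comparison -/

section Net

open Module Metric

variable {E : Type*} [NormedAddCommGroup E] [NormedSpace ℝ E] [FiniteDimensional ℝ E]

/-- The volume bound for separated subsets of the unit sphere. -/
theorem card_le_of_separated_sphere {ε : ℝ} (hε : 0 < ε) (hε1 : ε ≤ 1) (s : Finset E)
    (hs : ∀ c ∈ s, ‖c‖ = 1) (h : ∀ c ∈ s, ∀ d ∈ s, c ≠ d → ε ≤ ‖c - d‖) :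
    (s.card : ℝ) ≤ (3 / ε) ^ finrank ℝ E := by
  borelize E
  let μ : Measure E := Measure.addHaar
  have hδ : 0 < ε / 2 := by positivity
  have hρ : 0 < 1 + ε / 2 := by positivity
  have hD : Set.Pairwise (s : Set E) (Function.onFun Disjoint fun c => ball (c : E) (ε / 2)) := by
    rintro c hc d hd hcd
    apply ball_disjoint_ball
    rw [dist_eq_norm]
    linarith [h c hc d hd hcd]
  have hsub : (⋃ c ∈ s, ball (c : E) (ε / 2)) ⊆ ball (0 : E) (1 + ε / 2) := by
    refine Set.iUnion₂_subset fun x hx => ball_subset_ball' ?_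
    rw [dist_zero_right, hs x hx]
    linarith
  have I : (s.card : ENNReal) * ENNReal.ofReal ((ε / 2) ^ finrank ℝ E) * μ (ball 0 1) ≤
      ENNReal.ofReal ((1 + ε / 2) ^ finrank ℝ E) * μ (ball 0 1) :=
    calc
      _ = μ (⋃ c ∈ s, ball (c : E) (ε / 2)) := by
        rw [measure_biUnion_finset hD fun c _ => measurableSet_ball]
        simp only [μ.addHaar_ball_of_pos _ hδ]
        simp only [Finset.sum_const, nsmul_eq_mul, mul_assoc]
      _ ≤ μ (ball (0 : E) (1 + ε / 2)) := measure_mono hsub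
      _ = _ := by simp only [μ.addHaar_ball_of_pos _ hρ]
  have J := (ENNReal.mul_le_mul_iff_left
    (measure_ball_pos μ _ zero_lt_one).ne' measure_ball_lt_top.ne).1 I
  have J' := ENNReal.toReal_le_of_le_ofReal (pow_nonneg hρ.le _) J
  rw [ENNReal.toReal_mul, ENNReal.toReal_natCast, ENNReal.toReal_ofReal (by positivity)] at J'
  calc (s.card : ℝ) ≤ (1 + ε / 2) ^ finrank ℝ E / (ε / 2) ^ finrank ℝ E := by
        rwa [le_div_iff₀ (by positivity)]
    _ = ((1 + ε / 2) / (ε / 2)) ^ finrank ℝ E := (div_pow _ _ _).symm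
    _ ≤ (3 / ε) ^ finrank ℝ E := by
        gcongr ?_ ^ _
        rw [div_le_div_iff₀ hδ hε]
        nlinarith

/-- The unit sphere has an `ε`-net of cardinality at most `(3 / ε) ^ dim`. -/
theorem exists_net_sphere {ε : ℝ} (hε : 0 < ε) (hε1 : ε ≤ 1) :
    ∃ N : Finset E, (∀ n ∈ N, ‖n‖ = 1) ∧ (N.card : ℝ) ≤ (3 / ε) ^ finrank ℝ E ∧
      ∀ x : E, ‖x‖ = 1 → ∃ n ∈ N, ‖x - n‖ ≤ ε := by
  classical
  by_contra! hcon
  -- Greedy choice: a separated set that is not a net can be enlarged by a point, so separated sets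
  -- of every size would exist.
  have key : ∀ k : ℕ, ∃ s : Finset E, s.card = k ∧ (∀ c ∈ s, ‖c‖ = 1) ∧
      ∀ c ∈ s, ∀ d ∈ s, c ≠ d → ε ≤ ‖c - d‖ := by
    intro k
    induction k with
    | zero => exact ⟨∅, by simp⟩
    | succ k ih =>
      obtain ⟨s, hk, hs, hsep⟩ := ih
      obtain ⟨x, hx, hxs⟩ := hcon s hs (card_le_of_separated_sphere hε hε1 s hs hsep)
      have hxn : x ∉ s := fun hm => by
        have := hxs x hm
        rw [sub_self, norm_zero] at this
        linarith
      refine ⟨insert x s, by rw [Finset.card_insert_of_notMem hxn, hk], ?_, ?_⟩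
      · intro c hc
        rcases Finset.mem_insert.1 hc with rfl | hc
        exacts [hx, hs c hc]
      · intro c hc d hd hcd
        rcases Finset.mem_insert.1 hc with hc' | hc' <;>
          rcases Finset.mem_insert.1 hd with hd' | hd'
        · exact absurd (hc'.trans hd'.symm) hcd
        · rw [hc']; exact (hxs d hd').le
        · rw [hd', norm_sub_rev]; exact (hxs c hc').le
        · exact hsep c hc' d hd' hcd
  obtain ⟨k, hk⟩ := exists_nat_gt ((3 / ε) ^ finrank ℝ E)
  obtain ⟨s, hsk, hs, hsep⟩ := key k
  have := card_le_of_separated_sphere hε hε1 s hs hsep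
  rw [hsk] at this
  linarith

end Net

/-! ### From a net to the whole space -/

section LinearNet

open Module

variable {V F G : Type*} [AddCommGroup V] [Module ℝ V]
  [NormedAddCommGroup F] [NormedSpace ℝ F]
  [NormedAddCommGroup G] [NormedSpace ℝ G]

/-- A net of the unit sphere of the seminorm `x ↦ ‖L x‖`. -/
theorem exists_net_linearMap [FiniteDimensional ℝ F] (L : V →ₗ[ℝ] F) {ε : ℝ} (hε : 0 < ε) (hε1 : ε ≤ 1) :
    ∃ N : Finset V, (∀ n ∈ N, ‖L n‖ = 1) ∧ (N.card : ℝ) ≤ (3 / ε) ^ finrank ℝ (LinearMap.range L) ∧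
      ∀ x : V, ‖L x‖ = 1 → ∃ n ∈ N, ‖L (x - n)‖ ≤ ε := by
  classical
  -- The net lives in the range and is lifted by chosen preimages, so its size depends on the rank
  -- of `L` and not on `V`.
  obtain ⟨N, hN, hcard, hnet⟩ := exists_net_sphere (E := LinearMap.range L) hε hε1
  choose g hg using fun y : LinearMap.range L => y.2
  refine ⟨N.image g, ?_, ?_, ?_⟩
  · intro n hn
    obtain ⟨y, hy, rfl⟩ := Finset.mem_image.1 hn
    rw [hg]
    exact hN y hy
  · exact le_trans (by exact_mod_cast Finset.card_image_le) hcard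
  · intro x hx
    obtain ⟨n, hn, hxn⟩ := hnet ⟨L x, x, rfl⟩ hx
    refine ⟨g n, Finset.mem_image_of_mem g hn, ?_⟩
    rw [map_sub, hg]
    exact hxn

/-- A bound on a net extends to the whole space. -/
theorem norm_le_of_net [FiniteDimensional ℝ F] (L : V →ₗ[ℝ] F) (B : V →ₗ[ℝ] G)
    (hker : LinearMap.ker L ≤ LinearMap.ker B) {ε r : ℝ} (hε1 : ε < 1) (hr : 0 ≤ r)
    {N : Finset V} (hnet : ∀ x : V, ‖L x‖ = 1 → ∃ n ∈ N, ‖L (x - n)‖ ≤ ε)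
    (hB : ∀ n ∈ N, ‖B n‖ ≤ r) (x : V) : ‖B x‖ ≤ r / (1 - ε) * ‖L x‖ := by
  -- Since `B` kills `ker L`, it factors through the range of `L`. The factor `T` has a finite norm,
  -- so `‖T‖ ≤ r + ε ‖T‖` can be solved for `‖T‖`.
  obtain ⟨g, hg⟩ := LinearMap.exists_rightInverse_of_surjective L.rangeRestrict
    L.range_rangeRestrict
  have hfac : ∀ x, (B ∘ₗ g) (L.rangeRestrict x) = B x := by
    intro x
    have h1 : L (g (L.rangeRestrict x)) = L x := by
      have := congrArg Subtype.val (LinearMap.congr_fun hg (L.rangeRestrict x))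
      simpa using this
    have h2 : g (L.rangeRestrict x) - x ∈ LinearMap.ker B := hker (by
      rw [LinearMap.mem_ker, map_sub, h1, sub_self])
    rw [LinearMap.mem_ker, map_sub, sub_eq_zero] at h2
    exact h2
  set T : LinearMap.range L →L[ℝ] G := LinearMap.toContinuousLinearMap (B ∘ₗ g) with hT
  have hTL : ∀ x, T (L.rangeRestrict x) = B x := hfac
  have hLn : ∀ x, ‖L.rangeRestrict x‖ = ‖L x‖ := fun x => rfl
  have hunit : ∀ y : LinearMap.range L, ‖y‖ = 1 → ‖T y‖ ≤ r + ‖T‖ * ε := by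
    rintro ⟨_, x, rfl⟩ hy
    obtain ⟨n, hn, hxn⟩ := hnet x hy
    change ‖T (L.rangeRestrict x)‖ ≤ _
    have : T (L.rangeRestrict x) = B n + T (L.rangeRestrict (x - n)) := by
      rw [hTL, hTL, map_sub]; abel
    rw [this]
    refine (norm_add_le _ _).trans (add_le_add (hB n hn) ((T.le_opNorm _).trans ?_))
    gcongr
    exact hxn
  have hε0 : 0 ≤ r + ‖T‖ * ε ∨ Subsingleton (LinearMap.range L) := by
    by_cases hne : ∃ y : LinearMap.range L, ‖y‖ = 1
    · obtain ⟨y, hy⟩ := hne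
      exact Or.inl ((norm_nonneg _).trans (hunit y hy))
    · right
      by_contra hns
      rw [not_subsingleton_iff_nontrivial] at hns
      exact hne (exists_norm_eq _ zero_le_one)
  have hnorm : ‖T‖ ≤ r / (1 - ε) := by
    rcases hε0 with h0 | hsub
    · have : ‖T‖ ≤ r + ‖T‖ * ε := by
        refine T.opNorm_le_of_unit_norm h0 ?_
        intro y hy
        exact hunit y hy
      rw [le_div_iff₀ (by linarith)]
      linarith
    · rw [T.opNorm_subsingleton]
      exact div_nonneg hr (by linarith)
  calc ‖B x‖ = ‖T (L.rangeRestrict x)‖ := by rw [hTL]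
    _ ≤ ‖T‖ * ‖L x‖ := T.le_opNorm _
    _ ≤ _ := by gcongr

/-- A lower bound on a net, together with a global upper bound, gives a global lower bound. -/
theorem le_norm_of_net (L : V →ₗ[ℝ] F) (B : V →ₗ[ℝ] G) {ε R r : ℝ} (hR : 0 ≤ R)
    {N : Finset V} (hnet : ∀ x : V, ‖L x‖ = 1 → ∃ n ∈ N, ‖L (x - n)‖ ≤ ε)
    (hB : ∀ n ∈ N, r ≤ ‖B n‖) (hup : ∀ x, ‖B x‖ ≤ R * ‖L x‖) (x : V) :
    (r - R * ε) * ‖L x‖ ≤ ‖B x‖ := by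
  have hunit : ∀ x, ‖L x‖ = 1 → r - R * ε ≤ ‖B x‖ := by
    intro x hx
    obtain ⟨n, hn, hxn⟩ := hnet x hx
    have h1 : ‖B n‖ ≤ ‖B x‖ + ‖B (x - n)‖ := by
      have : B n = B x - B (x - n) := by rw [map_sub]; abel
      rw [this]
      exact norm_sub_le _ _
    have h2 : ‖B (x - n)‖ ≤ R * ε := (hup _).trans (by gcongr)
    linarith [hB n hn]
  by_cases hx : ‖L x‖ = 0
  · rw [hx, mul_zero]; exact norm_nonneg _
  · have h := hunit (‖L x‖⁻¹ • x) (by rw [map_smul, norm_smul, norm_inv, norm_norm,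
      inv_mul_cancel₀ hx])
    rw [map_smul, norm_smul, norm_inv, norm_norm] at h
    have hpos : 0 < ‖L x‖ := lt_of_le_of_ne (norm_nonneg _) (Ne.symm hx)
    calc (r - R * ε) * ‖L x‖ ≤ (‖L x‖⁻¹ * ‖B x‖) * ‖L x‖ := by gcongr
      _ = ‖B x‖ := by field_simp

end LinearNet

/-! ### Exponential moments and Chernoff bounds -/

section Tails

/-- Chernoff's bound for a sum of independent random variables. -/
theorem chernoff_sum {Ω ι : Type*} [MeasurableSpace Ω] {P : Measure Ω} [Fintype ι]
    {X : ι → Ω → ℝ} (hind : iIndepFun X P) (hm : ∀ i, AEMeasurable (X i) P) {b : ι → ℝ}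
    (hpos : ∀ i, 0 < ∫ ω, Real.exp (X i ω) ∂P)
    (hb : ∀ i, ∫ ω, Real.exp (X i ω) ∂P ≤ Real.exp (b i)) (τ : ℝ) :
    P.real {ω | τ ≤ ∑ i, X i ω} ≤ Real.exp (∑ i, b i - τ) := by
  have hP : IsProbabilityMeasure P := hind.isProbabilityMeasure
  have h1 := hind.mgf_sum₀ (t := 1) hm Finset.univ
  simp only [mgf, one_mul, Finset.sum_apply] at h1
  have hle : ∫ ω, Real.exp (∑ i, X i ω) ∂P ≤ Real.exp (∑ i, b i) := by
    rw [h1, Real.exp_sum]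
    exact Finset.prod_le_prod (fun i _ => (hpos i).le) fun i _ => hb i
  -- A non-integrable function has integral `0` by convention, but this integral is a product of
  -- positive factors.
  have hint : Integrable (fun ω => Real.exp (∑ i, X i ω)) P := by
    by_contra hn
    rw [integral_undef hn] at h1
    exact (Finset.prod_pos fun i _ => hpos i).ne h1
  have := measure_ge_le_exp_mul_mgf (μ := P) (X := fun ω => ∑ i, X i ω) τ zero_le_one
    (by simpa using hint)
  simp only [mgf, one_mul] at this
  refine this.trans ?_
  rw [show ∑ i, b i - τ = -1 * τ + ∑ i, b i by ring, Real.exp_add]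
  gcongr

/-- This is `-log (1 - u) ≤ u + u²` without the logarithm, proved from quadratic bounds of `exp`,
one for each sign of `u`. -/
theorem one_le_exp_mul_one_sub {u : ℝ} (hu : |u| ≤ 1 / 2) : 1 ≤ Real.exp (u + u ^ 2) * (1 - u) := by
  obtain ⟨h1, h2⟩ := abs_le.1 hu
  rcases le_total 0 u with h | h
  · have := Real.quadratic_le_exp_of_nonneg (x := u + u ^ 2) (by positivity)
    have h3 : 1 ≤ (1 + (u + u ^ 2) + (u + u ^ 2) ^ 2 / 2) * (1 - u) := by
      have : 0 ≤ u ^ 2 * ((1 - u) - u ^ 2 * (1 + u)) := by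
        apply mul_nonneg (sq_nonneg _)
        nlinarith
      nlinarith
    refine h3.trans ?_
    gcongr
    linarith
  · have hw : |-(u + u ^ 2)| ≤ 1 := by rw [abs_le]; constructor <;> nlinarith
    have := (abs_le.1 (Real.abs_exp_sub_one_sub_id_le hw)).2
    have hE : Real.exp (-(u + u ^ 2)) ≤ 1 - u := by
      have : 0 ≤ u ^ 2 * (1 - (1 + u) ^ 2) := by
        apply mul_nonneg (sq_nonneg _)
        nlinarith
      nlinarith
    rw [Real.exp_neg] at hE
    have hp := Real.exp_pos (u + u ^ 2)
    calc (1 : ℝ) = Real.exp (u + u ^ 2) * (Real.exp (u + u ^ 2))⁻¹ := by field_simp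
      _ ≤ _ := by gcongr

theorem integral_exp_mul_sq_gaussianReal {θ : ℝ} (hθ : θ < 1 / 2) :
    ∫ x, Real.exp (θ * x ^ 2) ∂(gaussianReal 0 1) = √(1 / (1 - 2 * θ)) := by
  rw [integral_gaussianReal_eq_integral_smul one_ne_zero]
  have : ∀ x : ℝ, gaussianPDFReal 0 1 x • Real.exp (θ * x ^ 2) =
      (√(2 * Real.pi))⁻¹ * Real.exp (-(1 / 2 - θ) * x ^ 2) := by
    intro x
    simp only [gaussianPDFReal, smul_eq_mul, NNReal.coe_one, mul_one, sub_zero]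
    rw [mul_assoc, ← Real.exp_add]
    congr 2
    ring
  simp_rw [this]
  rw [integral_const_mul, integral_gaussian, ← Real.sqrt_inv, ← Real.sqrt_mul (by positivity)]
  congr 1
  have : 1 / 2 - θ ≠ 0 := by linarith
  have : 1 - 2 * θ ≠ 0 := by linarith
  field_simp

/-- After rescaling, the integral is `(1 - 2 θ v) ^ (-1/2)`, and the previous inequality applies
with `u = 2 θ v`. Both signs of `θ` are admitted, for upper and lower tails. -/
theorem integral_exp_sq_gaussianReal_pos_le {v : NNReal} {θ : ℝ} (hθ : |θ| * v ≤ 1 / 4) :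
    0 < ∫ x, Real.exp (θ * x ^ 2) ∂(gaussianReal 0 v) ∧
    ∫ x, Real.exp (θ * x ^ 2) ∂(gaussianReal 0 v) ≤ Real.exp (θ * v + 2 * (θ * v) ^ 2) := by
  have hmap : gaussianReal 0 v = (gaussianReal 0 1).map (√(v : ℝ) * ·) := by
    rw [gaussianReal_map_const_mul]
    congr 1
    · simp
    · ext; simp
  have habs : |θ * v| ≤ 1 / 4 := by rwa [abs_mul, abs_of_nonneg v.coe_nonneg]
  obtain ⟨h1, h2⟩ := abs_le.1 habs
  have hval : ∫ x, Real.exp (θ * x ^ 2) ∂(gaussianReal 0 v) = √(1 / (1 - 2 * (θ * v))) := by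
    rw [← integral_exp_mul_sq_gaussianReal (θ := θ * v) (by linarith), hmap,
      integral_map (by fun_prop) (by fun_prop)]
    congr 1 with x
    rw [mul_pow, Real.sq_sqrt v.coe_nonneg, mul_assoc]
  have hp : 0 < 1 - 2 * (θ * v) := by linarith
  rw [hval]
  refine ⟨by positivity, ?_⟩
  rw [Real.sqrt_le_left (Real.exp_pos _).le, ← Real.exp_nat_mul, div_le_iff₀ hp]
  have := one_le_exp_mul_one_sub (u := 2 * (θ * v)) (by rw [abs_le]; constructor <;> linarith)
  rwa [show ((2 : ℕ) : ℝ) * (θ * v + 2 * (θ * v) ^ 2) = 2 * (θ * v) + (2 * (θ * v)) ^ 2 by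
    push_cast; ring]

theorem integral_exp_mul_gaussianReal (v : NNReal) (c : ℝ) :
    ∫ x, Real.exp (c * x) ∂(gaussianReal 0 v) = Real.exp (v * c ^ 2 / 2) := by
  have := congrFun (mgf_id_gaussianReal (μ := 0) (v := v)) c
  simpa [mgf] using this

end Tails

section Pointwise

variable {Ω : Type*} [MeasurableSpace Ω] {P : Measure Ω} {K : ℕ} {η : Fin K → Ω → ℝ} {v : NNReal}

/-- Tail of a linear form in independent centred normal variables. -/
theorem gaussian_linear_tail (hlaw : ∀ k, HasLaw (η k) (gaussianReal 0 v) P)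
    (hind : iIndepFun η P) (c : Fin K → ℝ) (τ : ℝ) :
    P.real {ω | τ ≤ ∑ k, c k * η k ω} ≤ Real.exp (v * (∑ k, c k ^ 2) / 2 - τ) := by
  have hint : ∀ k, ∫ ω, Real.exp (c k * η k ω) ∂P = Real.exp (v * c k ^ 2 / 2) := fun k => by
    rw [← integral_exp_mul_gaussianReal, ← (hlaw k).map_eq,
      integral_map (hlaw k).aemeasurable (by fun_prop)]
  have := chernoff_sum (X := fun k ω => c k * η k ω) (b := fun k => v * c k ^ 2 / 2)
    (hind.comp (fun k x => c k * x) fun k => by fun_prop)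
    (fun k => (hlaw k).aemeasurable.const_mul _)
    (fun k => by rw [hint]; positivity) (fun k => (hint k).le) τ
  rwa [← Finset.sum_div, ← Finset.mul_sum] at this

/-- Tail of a multiple of a sum of squares of independent centred normal variables. -/
theorem gaussian_square_tail (hlaw : ∀ k, HasLaw (η k) (gaussianReal 0 v) P)
    (hind : iIndepFun η P) {θ : ℝ} (hθ : |θ| * v ≤ 1 / 4) (τ : ℝ) :
    P.real {ω | τ ≤ θ * ∑ k, η k ω ^ 2} ≤ Real.exp (K * (θ * v + 2 * (θ * v) ^ 2) - τ) := by
  have hint : ∀ k, ∫ ω, Real.exp (θ * η k ω ^ 2) ∂P =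
      ∫ x, Real.exp (θ * x ^ 2) ∂(gaussianReal 0 v) := fun k => by
    rw [← (hlaw k).map_eq, integral_map (hlaw k).aemeasurable (by fun_prop)]
  have := chernoff_sum (X := fun k ω => θ * η k ω ^ 2) (b := fun _ => θ * v + 2 * (θ * v) ^ 2)
    (hind.comp (fun k x => θ * x ^ 2) fun k => by fun_prop)
    (fun k => ((hlaw k).aemeasurable.pow_const 2).const_mul _)
    (fun k => by rw [hint]; exact (integral_exp_sq_gaussianReal_pos_le hθ).1)
    (fun k => by rw [hint]; exact (integral_exp_sq_gaussianReal_pos_le hθ).2) τ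
  simpa [Finset.mul_sum, mul_add] using this

end Pointwise

/-! ### Centring, and concentration in one direction -/

section Centering

variable {K : ℕ}

/-- Centring is an orthogonal projection, so it can be moved onto `y` in the cross term. The sums in
`e` then have independent summands, and the coupling sits in the square of one linear form. -/
theorem sum_add_centered_sq (hK : 0 < K) (y e : Fin K → ℝ) :
    ∑ k, (y k + (e k - (K : ℝ)⁻¹ * ∑ j, e j)) ^ 2 =
      ∑ k, y k ^ 2 + 2 * ∑ k, (y k - (K : ℝ)⁻¹ * ∑ j, y j) * e k + ∑ k, e k ^ 2 -
        (K : ℝ)⁻¹ * (∑ k, e k) ^ 2 := by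
  have hK' : (K : ℝ) ≠ 0 := by positivity
  set m := (K : ℝ)⁻¹ * ∑ j, e j with hm
  set z := (K : ℝ)⁻¹ * ∑ j, y j with hz
  have hes : ∑ j, e j = K * m := by rw [hm]; field_simp
  have hys : ∑ j, y j = K * z := by rw [hz]; field_simp
  have h1 : ∀ k, (y k + (e k - m)) ^ 2 =
      y k ^ 2 + 2 * ((y k - z) * e k) + e k ^ 2 + 2 * z * e k - 2 * m * y k - 2 * m * e k + m ^ 2 :=
    fun k => by ring
  simp_rw [h1]
  simp only [Finset.sum_add_distrib, Finset.sum_sub_distrib, ← Finset.mul_sum, Finset.sum_const,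
    Finset.card_univ, Fintype.card_fin, nsmul_eq_mul, hes, hys]
  field_simp
  ring

theorem sum_centered_sq_le (hK : 0 < K) (y : Fin K → ℝ) :
    ∑ k, (y k - (K : ℝ)⁻¹ * ∑ j, y j) ^ 2 ≤ ∑ k, y k ^ 2 := by
  have := sum_add_centered_sq hK 0 y
  simp only [Pi.zero_apply, zero_add, ne_eq, OfNat.ofNat_ne_zero, not_false_eq_true, zero_pow,
    Finset.sum_const_zero, mul_zero, sub_self, zero_mul, add_zero] at this
  rw [this]
  have : 0 ≤ (K : ℝ)⁻¹ * (∑ k, y k) ^ 2 := by positivity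
  linarith

theorem sum_add_centered_sq_le (hK : 0 < K) (y e : Fin K → ℝ) :
    ∑ k, (y k + (e k - (K : ℝ)⁻¹ * ∑ j, e j)) ^ 2 ≤ 2 * ∑ k, y k ^ 2 + 2 * ∑ k, e k ^ 2 := by
  have h := sum_centered_sq_le hK e
  calc _ ≤ ∑ k, (2 * y k ^ 2 + 2 * (e k - (K : ℝ)⁻¹ * ∑ j, e j) ^ 2) :=
        Finset.sum_le_sum fun k _ => by nlinarith [sq_nonneg (y k - (e k - (K : ℝ)⁻¹ * ∑ j, e j))]
    _ ≤ _ := by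
        rw [Finset.sum_add_distrib, ← Finset.mul_sum, ← Finset.mul_sum]
        linarith

end Centering

section Pointwise

variable {Ω : Type*} [MeasurableSpace Ω] {P : Measure Ω} {K : ℕ} {η : Fin K → Ω → ℝ} {v : NNReal}

/-- Deviation of the cross term of a shifted sample. -/
theorem cross_term_tail (hlaw : ∀ k, HasLaw (η k) (gaussianReal 0 v) P)
    (hind : iIndepFun η P) {w : Fin K → ℝ} {n δ s σ : ℝ} (hn : 0 < n) (hs : 0 < s)
    (hvs : (v : ℝ) ≤ s) (hw : ∑ k, w k ^ 2 ≤ n * s) (hσ : σ ^ 2 = 1) :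
    P.real {ω | n * δ ^ 2 / 36 ≤ σ * (δ / (6 * s)) * ∑ k, w k * η k ω} ≤
      Real.exp (-(δ ^ 2 * n / 144)) := by
  -- The threshold means that the cross sum is at least `n s δ / 6` in the direction `σ`. The
  -- variance costs at most `n δ² / 72` of the exponent.
  have h := gaussian_linear_tail hlaw hind (fun k => σ * (δ / (6 * s)) * w k) (n * δ ^ 2 / 36)
  simp_rw [mul_assoc (σ * (δ / (6 * s))), ← Finset.mul_sum] at h
  refine h.trans (Real.exp_le_exp.2 ?_)
  have h1 : ∑ k, (σ * (δ / (6 * s)) * w k) ^ 2 = (δ / (6 * s)) ^ 2 * ∑ k, w k ^ 2 := by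
    rw [Finset.mul_sum]
    refine Finset.sum_congr rfl fun k _ => ?_
    rw [mul_pow, mul_pow, hσ, one_mul]
  rw [h1]
  have h2 : (v : ℝ) * ((δ / (6 * s)) ^ 2 * ∑ k, w k ^ 2) ≤
      s * ((δ / (6 * s)) ^ 2 * (n * s)) := by gcongr
  have h3 : s * ((δ / (6 * s)) ^ 2 * (n * s)) = n * δ ^ 2 / 36 := by field_simp; norm_num
  have : 0 ≤ n * δ ^ 2 := by positivity
  linarith

/-- Deviation of the sum of squares of a normal sample. -/
theorem square_term_tail (hlaw : ∀ k, HasLaw (η k) (gaussianReal 0 v) P)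
    (hind : iIndepFun η P) {n δ s σ : ℝ} (hn : 0 < n) (hKn : (K : ℝ) ≤ 2 * n) (hs : 0 < s)
    (hvs : (v : ℝ) ≤ s) (hδ : 0 < δ) (hδ1 : δ ≤ 1) (hσ : |σ| = 1) :
    P.real {ω | σ * (δ / (24 * s)) * (K * v) + n * δ ^ 2 / 72 ≤
      σ * (δ / (24 * s)) * ∑ k, η k ω ^ 2} ≤ Real.exp (-(δ ^ 2 * n / 144)) := by
  have h0 : δ / (24 * s) * v ≤ δ / 24 := by
    calc δ / (24 * s) * v ≤ δ / (24 * s) * s := by gcongr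
      _ = δ / 24 := by field_simp
  have h00 : 0 ≤ δ / (24 * s) * v := by positivity
  refine (gaussian_square_tail hlaw hind ?_ _).trans (Real.exp_le_exp.2 ?_)
  · rw [abs_mul, hσ, one_mul, abs_of_nonneg (by positivity)]
    linarith
  · have hσ2 : σ ^ 2 = 1 := by rw [← sq_abs, hσ, one_pow]
    have h1 : (σ * (δ / (24 * s)) * v) ^ 2 ≤ (δ / 24) ^ 2 := by
      rw [mul_assoc, mul_pow, hσ2, one_mul]
      gcongr
    have h2 : (K : ℝ) * (2 * (σ * (δ / (24 * s)) * v) ^ 2) ≤ (2 * n) * (2 * (δ / 24) ^ 2) := by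
      gcongr
    linarith

/-- Deviation of the mean of a normal sample. -/
theorem mean_term_tail (hK : 0 < K) (hlaw : ∀ k, HasLaw (η k) (gaussianReal 0 v) P)
    (hind : iIndepFun η P) {n δ s σ : ℝ} (hn : 0 < n) (hs : 0 < s)
    (hvs : (v : ℝ) ≤ s) (hδ : 0 < δ) (hδ1 : δ ≤ 1) (hσ : σ ^ 2 = 1) :
    P.real {ω | n * δ / 3 ≤ σ * √(n * δ / (3 * K * s)) * ∑ k, η k ω} ≤
      Real.exp (-(δ ^ 2 * n / 144)) := by
  have hK' : (0 : ℝ) < K := by exact_mod_cast hK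
  have h := gaussian_linear_tail hlaw hind (fun _ => σ * √(n * δ / (3 * K * s))) (n * δ / 3)
  simp_rw [← Finset.mul_sum] at h
  refine h.trans (Real.exp_le_exp.2 ?_)
  rw [Finset.sum_const, Finset.card_univ, Fintype.card_fin, nsmul_eq_mul, mul_pow, hσ, one_mul,
    Real.sq_sqrt (by positivity)]
  have h2 : (v : ℝ) * (K * (n * δ / (3 * K * s))) ≤ s * (K * (n * δ / (3 * K * s))) := by gcongr
  have h3 : s * (K * (n * δ / (3 * K * s))) = n * δ / 3 := by field_simp
  have h4 : δ ^ 2 ≤ δ := by nlinarith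
  have : n * δ ^ 2 ≤ n * δ := by gcongr
  have : 0 ≤ n * δ := by positivity
  linarith

theorem abs_le_of_scaled {a x b : ℝ} (ha : 0 < a) (h1 : 1 * a * x < a * b)
    (h2 : -1 * a * x < a * b) : |x| ≤ b := by
  have h1' : a * x < a * b := by linarith
  have h2' : a * (-x) < a * b := by linarith
  rw [abs_le]
  constructor
  · linarith [lt_of_mul_lt_mul_left h2' ha.le]
  · exact (lt_of_mul_lt_mul_left h1' ha.le).le

/-- Concentration of the squared length of a shifted centred Gaussian sample. -/
theorem shifted_sample_concentration (hK : 2 ≤ K) (hlaw : ∀ k, HasLaw (η k) (gaussianReal 0 v) P)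
    (hind : iIndepFun η P) (y : Fin K → ℝ) {δ s : ℝ} (hδ : 0 < δ) (hδ1 : δ ≤ 1) (hs : 0 < s)
    (hsy : ∑ k, y k ^ 2 + (K - 1) * v = (K - 1) * s) (hKδ : 3 ≤ δ * (K - 1)) :
    P.real {ω | ¬ ((1 - δ) * ((K - 1) * s) ≤
        ∑ k, (y k + (η k ω - (K : ℝ)⁻¹ * ∑ j, η j ω)) ^ 2 ∧
        ∑ k, (y k + (η k ω - (K : ℝ)⁻¹ * ∑ j, η j ω)) ^ 2 ≤ (1 + δ) * ((K - 1) * s))} ≤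
      6 * Real.exp (-(δ ^ 2 * (K - 1) / 144)) := by
  have hP : IsProbabilityMeasure P := hind.isProbabilityMeasure
  have hK2 : (2 : ℝ) ≤ K := by exact_mod_cast hK
  have hK0 : 0 < K := by omega
  have hv : (0 : ℝ) ≤ v := v.coe_nonneg
  obtain ⟨n, hn⟩ : ∃ n : ℝ, n = (K : ℝ) - 1 := ⟨_, rfl⟩
  rw [← hn] at hsy hKδ ⊢
  have hn1 : 1 ≤ n := by linarith
  have hn0 : 0 < n := by linarith
  have hsq : 0 ≤ ∑ k, y k ^ 2 := Finset.sum_nonneg fun k _ => sq_nonneg _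
  have hvs : (v : ℝ) ≤ s := by
    have : n * v ≤ n * s := by linarith
    exact le_of_mul_le_mul_left this hn0
  have hw2 : ∑ k, (y k - (K : ℝ)⁻¹ * ∑ j, y j) ^ 2 ≤ n * s := by
    have := sum_centered_sq_le hK0 y
    have : 0 ≤ n * v := by positivity
    linarith
  have hlin := fun (σ : ℝ) (hσ : σ ^ 2 = 1) =>
    cross_term_tail (δ := δ) hlaw hind hn0 hs hvs hw2 hσ
  have hsquare := fun (σ : ℝ) (hσ : |σ| = 1) =>
    square_term_tail hlaw hind hn0 (by linarith) hs hvs hδ hδ1 hσ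
  have hmean := fun (σ : ℝ) (hσ : σ ^ 2 = 1) =>
    mean_term_tail hK0 hlaw hind hn0 hs hvs hδ hδ1 hσ
  have key := fun ω => sum_add_centered_sq hK0 y (fun k => η k ω)
  simp_rw [key]
  generalize hA : (fun ω => ∑ k, (y k - (K : ℝ)⁻¹ * ∑ j, y j) * η k ω) = A
  generalize hQ : (fun ω => ∑ k, η k ω ^ 2) = Q
  generalize hM : (fun ω => ∑ k, η k ω) = M
  simp only [funext_iff] at hA hQ hM
  simp only [hA, hQ, hM] at hlin hsquare hmean ⊢
  have hsub : {ω | ¬ ((1 - δ) * (n * s) ≤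
        ∑ k, y k ^ 2 + 2 * A ω + Q ω - (K : ℝ)⁻¹ * M ω ^ 2 ∧
        ∑ k, y k ^ 2 + 2 * A ω + Q ω - (K : ℝ)⁻¹ * M ω ^ 2 ≤ (1 + δ) * (n * s))} ⊆
      (({ω | n * δ ^ 2 / 36 ≤ 1 * (δ / (6 * s)) * A ω} ∪
      {ω | n * δ ^ 2 / 36 ≤ -1 * (δ / (6 * s)) * A ω}) ∪
      ({ω | 1 * (δ / (24 * s)) * (K * v) + n * δ ^ 2 / 72 ≤ 1 * (δ / (24 * s)) * Q ω} ∪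
      {ω | -1 * (δ / (24 * s)) * (K * v) + n * δ ^ 2 / 72 ≤ -1 * (δ / (24 * s)) * Q ω})) ∪
      ({ω | n * δ / 3 ≤ 1 * √(n * δ / (3 * K * s)) * M ω} ∪
      {ω | n * δ / 3 ≤ -1 * √(n * δ / (3 * K * s)) * M ω}) := by
    intro ω hω
    by_contra hcon
    simp only [Set.mem_union, Set.mem_ofPred_eq, not_or, not_le] at hcon
    obtain ⟨⟨⟨h1, h2⟩, h3, h4⟩, h5, h6⟩ := hcon
    refine hω ?_
    have hA1 : |A ω| ≤ n * s * δ / 6 := by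
      have he : n * δ ^ 2 / 36 = δ / (6 * s) * (n * s * δ / 6) := by field_simp; norm_num
      rw [he] at h1 h2
      exact abs_le_of_scaled (by positivity) h1 h2
    have hQ1 : |Q ω - K * v| ≤ n * s * δ / 3 := by
      have he : n * δ ^ 2 / 72 = δ / (24 * s) * (n * s * δ / 3) := by field_simp; norm_num
      rw [he] at h3 h4
      exact abs_le_of_scaled (a := δ / (24 * s)) (by positivity) (by linarith) (by linarith)
    have hM1 : (K : ℝ)⁻¹ * M ω ^ 2 ≤ n * s * δ / 3 := by
      set r := √(n * δ / (3 * K * s)) with hr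
      have hr2 : r ^ 2 = n * δ / (3 * K * s) := Real.sq_sqrt (by positivity)
      have habs : |r * M ω| ≤ n * δ / 3 := by
        rw [abs_le]; constructor <;> linarith
      have hsq' : (r * M ω) ^ 2 ≤ (n * δ / 3) ^ 2 := by
        rw [← sq_abs (r * M ω)]; gcongr
      rw [mul_pow, hr2] at hsq'
      have e2 : n * δ / (3 * K * s) * M ω ^ 2 = (n * δ / (3 * s)) * ((K : ℝ)⁻¹ * M ω ^ 2) := by
        field_simp
      have e3 : (n * δ / 3) ^ 2 = (n * δ / (3 * s)) * (n * s * δ / 3) := by field_simp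
      rw [e2, e3] at hsq'
      exact le_of_mul_le_mul_left hsq' (by positivity)
    have hM0 : 0 ≤ (K : ℝ)⁻¹ * M ω ^ 2 := by positivity
    obtain ⟨a1, a2⟩ := abs_le.1 hA1
    obtain ⟨b1, b2⟩ := abs_le.1 hQ1
    -- The error budget `n s δ` is split in thirds. Above, they pay for the cross term, the squares
    -- and the excess `v` of `K v` over `n v`; below, the mean term replaces that excess.
    have hv3 : (v : ℝ) ≤ n * s * δ / 3 := by
      have : s * 3 ≤ s * (δ * n) := by gcongr
      linarith
    have hKv : (K : ℝ) * v = n * v + v := by rw [hn]; ring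
    constructor <;> linarith
  refine (measureReal_mono hsub).trans ?_
  refine (measureReal_union_le _ _).trans ?_
  refine (add_le_add ((measureReal_union_le _ _).trans (add_le_add (measureReal_union_le _ _)
    (measureReal_union_le _ _))) (measureReal_union_le _ _)).trans ?_
  linarith [hlin 1 (by norm_num), hlin (-1) (by norm_num), hsquare 1 (by norm_num),
    hsquare (-1) (by norm_num), hmean 1 (by norm_num), hmean (-1) (by norm_num)]

/-- Upper tail of the squared length of a shifted centred Gaussian sample. -/
theorem shifted_sample_upper_tail (hK : 2 ≤ K) (hlaw : ∀ k, HasLaw (η k) (gaussianReal 0 v) P)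
    (hind : iIndepFun η P) (y : Fin K → ℝ) {s : ℝ} (hs : 0 < s)
    (hsy : ∑ k, y k ^ 2 + (K - 1) * v = (K - 1) * s) (u : ℝ) :
    P.real {ω | ¬ (∑ k, (y k + (η k ω - (K : ℝ)⁻¹ * ∑ j, η j ω)) ^ 2 ≤ u * ((K - 1) * s))} ≤
      Real.exp (3 * K / 8 - (u - 2) * (K - 1) / 8) := by
  have hP : IsProbabilityMeasure P := hind.isProbabilityMeasure
  have hK2 : (2 : ℝ) ≤ K := by exact_mod_cast hK
  have hK0 : 0 < K := by omega
  have hv : (0 : ℝ) ≤ v := v.coe_nonneg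
  have hsq : 0 ≤ ∑ k, y k ^ 2 := Finset.sum_nonneg fun k _ => sq_nonneg _
  have hvs : (v : ℝ) ≤ s := by nlinarith
  have h0 : 1 / (4 * s) * v ≤ 1 / 4 := by
    calc 1 / (4 * s) * v ≤ 1 / (4 * s) * s := by gcongr
      _ = 1 / 4 := by field_simp
  have h00 : 0 ≤ 1 / (4 * s) * v := by positivity
  have hsub : {ω | ¬ (∑ k, (y k + (η k ω - (K : ℝ)⁻¹ * ∑ j, η j ω)) ^ 2 ≤ u * ((K - 1) * s))} ⊆
      {ω | (u - 2) * (K - 1) / 8 ≤ 1 / (4 * s) * ∑ k, η k ω ^ 2} := by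
    intro ω hω
    by_contra hcon
    simp only [Set.mem_ofPred_eq, not_le] at hcon
    -- The signal part costs at most `2 (K - 1) s`, whence `u - 2` remains for the noise.
    refine hω ((sum_add_centered_sq_le hK0 _ _).trans ?_)
    have : ∑ k, η k ω ^ 2 ≤ (u - 2) * (K - 1) * s / 2 := by
      have e : (u - 2) * (K - 1) / 8 = 1 / (4 * s) * ((u - 2) * (K - 1) * s / 2) := by
        field_simp; ring
      rw [e] at hcon
      exact (lt_of_mul_lt_mul_left hcon (by positivity)).le
    have : 0 ≤ ((K : ℝ) - 1) * v := mul_nonneg (by linarith) hv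
    nlinarith
  refine (measureReal_mono hsub).trans ?_
  refine (gaussian_square_tail hlaw hind ?_ _).trans (Real.exp_le_exp.2 ?_)
  · rwa [abs_of_nonneg (by positivity)]
  · have : (K : ℝ) * (1 / (4 * s) * v + 2 * (1 / (4 * s) * v) ^ 2) ≤ K * (1 / 4 + 2 * (1 / 4) ^ 2) := by
      gcongr
    linarith

end Pointwise

/-! ### Union bound over a net -/

section NetUnion

open Module

/-- A union bound over a net of the unit sphere of the seminorm `x ↦ ‖L x‖`. -/
theorem measure_compl_le_of_net {Ω V F G : Type*} [MeasurableSpace Ω] {P : Measure Ω}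
    [IsFiniteMeasure P] [AddCommGroup V] [Module ℝ V] [FiniteDimensional ℝ V]
    [NormedAddCommGroup F] [NormedSpace ℝ F] [FiniteDimensional ℝ F]
    [AddCommGroup G] [Module ℝ G] (L : V →ₗ[ℝ] F) (B : Ω → V →ₗ[ℝ] G)
    (hker : ∀ x, L x = 0 → ∀ᵐ ω ∂P, B ω x = 0) {ε β : ℝ} (hε : 0 < ε) (hε1 : ε ≤ 1) (hβ : 0 ≤ β)
    {m : ℕ} (hm : finrank ℝ (LinearMap.range L) ≤ m) (good : G → Prop)
    (hgood : 0 < m → ∀ x, ‖L x‖ = 1 → P.real {ω | ¬ good (B ω x)} ≤ β) (Q : Ω → Prop)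
    (hQ : ∀ (N : Finset V) (ω : Ω), (∀ x : V, ‖L x‖ = 1 → ∃ n ∈ N, ‖L (x - n)‖ ≤ ε) →
      LinearMap.ker L ≤ LinearMap.ker (B ω) → (∀ n ∈ N, good (B ω n)) → Q ω) :
    P.real {ω | ¬ Q ω} ≤ m * (3 / ε) ^ m * β := by
  obtain ⟨N, hN1, hcard, hnet⟩ := exists_net_linearMap L hε hε1
  -- A finite spanning set of the kernel turns the pointwise almost sure statements into one almost
  -- sure inclusion.
  obtain ⟨s, hs⟩ := IsNoetherian.noetherian (LinearMap.ker L)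
  have hae : P.real {ω | ¬ LinearMap.ker L ≤ LinearMap.ker (B ω)} = 0 := by
    have : ∀ᵐ ω ∂P, ∀ x ∈ s, B ω x = 0 := by
      rw [Finset.eventually_all]
      intro x hx
      refine hker x ?_
      have : x ∈ LinearMap.ker L := hs ▸ Submodule.subset_span hx
      exact this
    have h2 : ∀ᵐ ω ∂P, LinearMap.ker L ≤ LinearMap.ker (B ω) := by
      filter_upwards [this] with ω hω
      rw [← hs, Submodule.span_le]
      exact fun x hx => hω x hx
    rw [measureReal_def, ae_iff.1 h2, ENNReal.toReal_zero]
  have hsub : {ω | ¬ Q ω} ⊆ {ω | ¬ LinearMap.ker L ≤ LinearMap.ker (B ω)} ∪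
      ⋃ n ∈ N, {ω | ¬ good (B ω n)} := by
    intro ω hω
    by_contra hcon
    simp only [Set.mem_union, Set.mem_ofPred_eq, Set.mem_iUnion, not_or, not_not, not_exists] at hcon
    exact hω (hQ N ω hnet hcon.1 hcon.2)
  have hm1 : ∀ n ∈ N, 0 < m := by
    intro n hn
    by_contra hm0
    have h0 : finrank ℝ (LinearMap.range L) = 0 := by omega
    have hL : L n ∈ LinearMap.range L := ⟨n, rfl⟩
    rw [Submodule.finrank_eq_zero.1 h0, Submodule.mem_bot] at hL
    have := hN1 n hn
    rw [hL, norm_zero] at this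
    exact zero_ne_one this
  -- The factor `m` makes the bound vanish in rank `0`, where the net is empty. This later covers `p
  -- = 0`, where `K` need not be large.
  have hNm : (N.card : ℝ) ≤ m * (3 / ε) ^ m := by
    rcases N.eq_empty_or_nonempty with rfl | ⟨n, hn⟩
    · rw [Finset.card_empty, Nat.cast_zero]; positivity
    · have h1 : (1 : ℝ) ≤ m := by exact_mod_cast hm1 n hn
      have h3 : 1 ≤ 3 / ε := by rw [le_div_iff₀ hε]; linarith
      calc (N.card : ℝ) ≤ (3 / ε) ^ finrank ℝ (LinearMap.range L) := hcard
        _ ≤ (3 / ε) ^ m := pow_le_pow_right₀ h3 hm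
        _ ≤ m * (3 / ε) ^ m := le_mul_of_one_le_left (by positivity) h1
  calc P.real {ω | ¬ Q ω} ≤ _ := measureReal_mono hsub
    _ ≤ 0 + P.real (⋃ n ∈ N, {ω | ¬ good (B ω n)}) := by
      rw [← hae]; exact measureReal_union_le _ _
    _ ≤ ∑ n ∈ N, P.real {ω | ¬ good (B ω n)} := by
      rw [zero_add]; exact measureReal_biUnion_finset_le _ _
    _ ≤ ∑ n ∈ N, β := Finset.sum_le_sum fun n hn => hgood (hm1 n hn) n (hN1 n hn)
    _ = N.card * β := by rw [Finset.sum_const, nsmul_eq_mul]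
    _ ≤ _ := by gcongr

end NetUnion

/-! ### Quadratic forms of the sample matrices -/

section Forms

open Matrix

variable {d K : ℕ}

theorem dotProduct_sampleCov (z : Fin K → EuclideanSpace ℝ (Fin d)) (x : Fin d → ℝ) :
    x ⬝ᵥ sampleCov z *ᵥ x = ((K : ℝ) - 1)⁻¹ * ∑ k, (x ⬝ᵥ (z k).ofLp) ^ 2 := by
  rw [sampleCov, smul_mulVec, dotProduct_smul, smul_eq_mul, sum_mulVec, dotProduct_sum]
  congr 1
  refine Finset.sum_congr rfl fun k _ => ?_
  rw [vecMulVec_mulVec, dotProduct_comm (z k).ofLp x]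
  simp [sq]

theorem dotProduct_deviation (x : Fin d → ℝ) (z : Fin K → EuclideanSpace ℝ (Fin d)) (k : Fin K) :
    x ⬝ᵥ (deviation z k).ofLp = x ⬝ᵥ (z k).ofLp - (K : ℝ)⁻¹ * ∑ j, x ⬝ᵥ (z j).ofLp := by
  rw [deviation, WithLp.ofLp_sub, WithLp.ofLp_smul, WithLp.ofLp_sum, dotProduct_sub,
    dotProduct_smul, dotProduct_sum, smul_eq_mul]

theorem dotProduct_noncentralCov (a z : Fin K → EuclideanSpace ℝ (Fin d)) (x : Fin d → ℝ) :
    x ⬝ᵥ noncentralCov a z *ᵥ x = ((K : ℝ) - 1)⁻¹ * ∑ k, (x ⬝ᵥ (a k).ofLp +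
      (x ⬝ᵥ (z k).ofLp - (K : ℝ)⁻¹ * ∑ j, x ⬝ᵥ (z j).ofLp)) ^ 2 := by
  rw [noncentralCov, dotProduct_sampleCov]
  simp_rw [WithLp.ofLp_add, dotProduct_add, dotProduct_deviation]

theorem isHermitian_sampleCov (z : Fin K → EuclideanSpace ℝ (Fin d)) :
    (sampleCov z).IsHermitian := by
  ext i j
  simp [sampleCov, Matrix.sum_apply, vecMulVec_apply, mul_comm]

theorem posSemidef_sampleCov (hK : 1 ≤ K) (z : Fin K → EuclideanSpace ℝ (Fin d)) :
    (sampleCov z).PosSemidef := by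
  refine PosSemidef.of_dotProduct_mulVec_nonneg (isHermitian_sampleCov z) fun x => ?_
  have : (1 : ℝ) ≤ K := by exact_mod_cast hK
  rw [star_trivial, dotProduct_sampleCov]
  exact mul_nonneg (inv_nonneg.2 (by linarith)) (Finset.sum_nonneg fun k _ => sq_nonneg _)

theorem rank_add_le (A B : Matrix (Fin d) (Fin d) ℝ) : (A + B).rank ≤ A.rank + B.rank := by
  rw [rank, rank, rank, mulVecLin_add]
  refine le_trans (Submodule.finrank_mono ?_)
    (Submodule.finrank_add_le_finrank_add_finrank A.mulVecLin.range B.mulVecLin.range)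
  rintro _ ⟨x, rfl⟩
  exact Submodule.add_mem_sup ⟨x, rfl⟩ ⟨x, rfl⟩

theorem rank_sampleCov_le (a : Fin K → EuclideanSpace ℝ (Fin d)) :
    (sampleCov a).rank ≤ (Matrix.of fun (i : Fin d) (k : Fin K) => a k i).rank := by
  have : sampleCov a = (((K : ℝ) - 1)⁻¹ • Matrix.of fun (i : Fin d) (k : Fin K) => a k i) *
      (Matrix.of fun (i : Fin d) (k : Fin K) => a k i)ᵀ := by
    ext i j
    simp [sampleCov, Matrix.sum_apply, vecMulVec_apply, mul_apply, Finset.mul_sum, mul_assoc]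
  rw [this]
  exact (rank_mul_le_right _ _).trans (rank_transpose _).le

open scoped MatrixOrder in
/-- A positive semidefinite quadratic form is the square of a Euclidean seminorm given by a linear
map of the same rank. -/
theorem exists_linearMap_form {D : Matrix (Fin d) (Fin d) ℝ} (hD : D.PosSemidef) :
    ∃ L : (Fin d → ℝ) →ₗ[ℝ] EuclideanSpace ℝ (Fin d),
      (∀ x, ‖L x‖ ^ 2 = x ⬝ᵥ D *ᵥ x) ∧ Module.finrank ℝ (LinearMap.range L) = D.rank := by
  obtain ⟨R, hR⟩ := CStarAlgebra.nonneg_iff_eq_star_mul_self.1 hD.nonneg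
  rw [star_eq_conjTranspose] at hR
  refine ⟨(WithLp.linearEquiv 2 ℝ (Fin d → ℝ)).symm.toLinearMap ∘ₗ R.mulVecLin, fun x => ?_, ?_⟩
  · rw [hR, EuclideanSpace.norm_sq_eq, ← mulVec_mulVec, dotProduct_mulVec, vecMul_conjTranspose]
    simp [dotProduct, sq]
  · rw [hR, rank_conjTranspose_mul_self, rank, LinearMap.range_comp]
    exact LinearEquiv.finrank_map_eq _ _

/-- The linear map whose squared norm is `(K - 1) xᵀ Z x`. -/
noncomputable def sampleMap (z : Fin K → EuclideanSpace ℝ (Fin d)) :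
    (Fin d → ℝ) →ₗ[ℝ] EuclideanSpace ℝ (Fin K) :=
  (WithLp.linearEquiv 2 ℝ (Fin K → ℝ)).symm.toLinearMap ∘ₗ
    (Matrix.of fun k i => z k i).mulVecLin

theorem norm_sampleMap_sq (z : Fin K → EuclideanSpace ℝ (Fin d)) (x : Fin d → ℝ) :
    ‖sampleMap z x‖ ^ 2 = ∑ k, (x ⬝ᵥ (z k).ofLp) ^ 2 := by
  rw [EuclideanSpace.norm_sq_eq]
  refine Finset.sum_congr rfl fun k _ => ?_
  rw [Real.norm_eq_abs, sq_abs, dotProduct_comm]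
  rfl

theorem norm_sampleMap_noncentral_sq (a z : Fin K → EuclideanSpace ℝ (Fin d)) (x : Fin d → ℝ) :
    ‖sampleMap (fun k => a k + deviation z k) x‖ ^ 2 = ∑ k, (x ⬝ᵥ (a k).ofLp +
      (x ⬝ᵥ (z k).ofLp - (K : ℝ)⁻¹ * ∑ j, x ⬝ᵥ (z j).ofLp)) ^ 2 := by
  rw [norm_sampleMap_sq]
  simp_rw [WithLp.ofLp_add, dotProduct_add, dotProduct_deviation]

end Forms

/-! ### Laws of one-dimensional projections -/

section Law

open Matrix

variable {Ω : Type*} [MeasurableSpace Ω] {P : Measure Ω} {d K : ℕ}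
  {S : Matrix (Fin d) (Fin d) ℝ}

theorem hasLaw_dotProduct (hS : S.PosSemidef) {X : Ω → EuclideanSpace ℝ (Fin d)}
    (hX : HasLaw X (multivariateGaussian 0 S) P) (x : Fin d → ℝ) :
    HasLaw (fun ω => x ⬝ᵥ (X ω).ofLp) (gaussianReal 0 (x ⬝ᵥ S *ᵥ x).toNNReal) P := by
  have h1 : HasLaw (fun y => x ⬝ᵥ y.ofLp) (gaussianReal 0 (x ⬝ᵥ S *ᵥ x).toNNReal)
      (multivariateGaussian 0 S) := by
    have hfun : (fun y : EuclideanSpace ℝ (Fin d) => x ⬝ᵥ y.ofLp) =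
        innerSL ℝ (WithLp.toLp 2 x) := by
      ext y
      simp [PiLp.inner_apply, dotProduct, mul_comm]
    rw [hfun]
    refine ⟨by fun_prop, ?_⟩
    rw [IsGaussian.map_eq_gaussianReal, ContinuousLinearMap.integral_comp_id_comm,
      integral_id_multivariateGaussian, map_zero]
    · congr 2
      have := covarianceBilin_self (μ := multivariateGaussian 0 S) IsGaussian.memLp_two_id
        (WithLp.toLp 2 x)
      rw [covarianceBilin_multivariateGaussian hS] at this
      exact this.symm
    · exact IsGaussian.integrable_id
  exact h1.comp hX

theorem iIndepFun_dotProduct {ξ : Fin K → Ω → EuclideanSpace ℝ (Fin d)} (hind : iIndepFun ξ P)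
    (x : Fin d → ℝ) : iIndepFun (fun k ω => x ⬝ᵥ (ξ k ω).ofLp) P := by
  refine hind.comp (fun _ y => x ⬝ᵥ y.ofLp) fun _ => ?_
  simp only [dotProduct]
  fun_prop

theorem ae_eq_zero_of_hasLaw {η : Ω → ℝ} (h : HasLaw η (gaussianReal 0 0) P) :
    ∀ᵐ ω ∂P, η ω = 0 := by
  rw [gaussianReal_zero_var] at h
  have : ∀ᵐ y ∂(P.map η), y = 0 := by
    rw [h.map_eq]
    simp [ae_dirac_eq]
  exact ae_of_ae_map h.aemeasurable this

end Law

/-! ### Bounds uniform over all directions -/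

section Uniform

open Matrix

variable {Ω : Type*} [MeasurableSpace Ω] {P : Measure Ω} {d K p : ℕ}
  {S : Matrix (Fin d) (Fin d) ℝ} {a : Fin K → EuclideanSpace ℝ (Fin d)}
  {ξ : Fin K → Ω → EuclideanSpace ℝ (Fin d)}

theorem dotProduct_mulVec_nonneg {M : Matrix (Fin d) (Fin d) ℝ} (hM : M.PosSemidef)
    (x : Fin d → ℝ) : 0 ≤ x ⬝ᵥ M *ᵥ x := by
  simpa using hM.dotProduct_mulVec_nonneg x

/-- The splitting of the form of `(K - 1) D` into signal and noise. -/
theorem sum_sq_add_variance (hK : 2 ≤ K) (hS : S.PosSemidef) (x : Fin d → ℝ) :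
    ∑ k, (x ⬝ᵥ (a k).ofLp) ^ 2 + ((K : ℝ) - 1) * (x ⬝ᵥ S *ᵥ x).toNNReal =
      ((K : ℝ) - 1) * (x ⬝ᵥ (sampleCov a + S) *ᵥ x) := by
  have hK2 : (2 : ℝ) ≤ K := by exact_mod_cast hK
  have : (K : ℝ) - 1 ≠ 0 := by linarith
  rw [add_mulVec, dotProduct_add, dotProduct_sampleCov,
    Real.coe_toNNReal _ (dotProduct_mulVec_nonneg hS x)]
  field_simp

/-- If `xᵀ D x = 0`, the signal and the noise variance both vanish along `x`, and a normal law of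
variance `0` is a point mass. This is the kernel condition of the net argument. -/
theorem noise_vanishes_of_form_eq_zero (hK : 2 ≤ K) (hS : S.PosSemidef)
    (hlaw : ∀ k, HasLaw (ξ k) (multivariateGaussian 0 S) P) {x : Fin d → ℝ}
    (hx : x ⬝ᵥ (sampleCov a + S) *ᵥ x = 0) :
    ∀ᵐ ω ∂P, sampleMap (fun k => a k + deviation (fun k => ξ k ω) k) x = 0 := by
  have hK2 : (2 : ℝ) ≤ K := by exact_mod_cast hK
  have h := sum_sq_add_variance (a := a) hK hS x
  rw [hx, mul_zero] at h
  have h1 : 0 ≤ ∑ k, (x ⬝ᵥ (a k).ofLp) ^ 2 := Finset.sum_nonneg fun k _ => sq_nonneg _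
  have h2 : 0 ≤ ((K : ℝ) - 1) * (x ⬝ᵥ S *ᵥ x).toNNReal :=
    mul_nonneg (by linarith) (NNReal.coe_nonneg _)
  have h3 : ∑ k, (x ⬝ᵥ (a k).ofLp) ^ 2 = 0 := by linarith
  have h4 : ((K : ℝ) - 1) * (x ⬝ᵥ S *ᵥ x).toNNReal = 0 := by linarith
  have h5 : (x ⬝ᵥ S *ᵥ x).toNNReal = 0 := by
    rcases mul_eq_zero.1 h4 with h | h
    · linarith
    · exact_mod_cast h
  have hy : ∀ k, x ⬝ᵥ (a k).ofLp = 0 := by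
    intro k
    have := (Finset.sum_eq_zero_iff_of_nonneg fun k _ => sq_nonneg _).1 h3 k (Finset.mem_univ k)
    exact pow_eq_zero_iff two_ne_zero |>.1 this
  have hη : ∀ᵐ ω ∂P, ∀ k, x ⬝ᵥ (ξ k ω).ofLp = 0 := by
    rw [ae_all_iff]
    intro k
    have := hasLaw_dotProduct hS (hlaw k) x
    rw [h5] at this
    exact ae_eq_zero_of_hasLaw this
  filter_upwards [hη] with ω hω
  rw [← norm_eq_zero, ← pow_eq_zero_iff two_ne_zero, norm_sampleMap_noncentral_sq]
  simp [hy, hω]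

theorem rank_form_le (ha : (Matrix.of fun (i : Fin d) (k : Fin K) => a k i).rank ≤ p)
    (hSp : S.rank ≤ p) : (sampleCov a + S).rank ≤ 2 * p := by
  have := rank_add_le (sampleCov a) S
  have := rank_sampleCov_le a
  omega

theorem noncentralCov_form_eq (z : Fin K → EuclideanSpace ℝ (Fin d)) (x : Fin d → ℝ) :
    x ⬝ᵥ noncentralCov a z *ᵥ x =
      ((K : ℝ) - 1)⁻¹ * ‖sampleMap (fun k => a k + deviation z k) x‖ ^ 2 := by
  rw [dotProduct_noncentralCov, norm_sampleMap_noncentral_sq]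

/-- Uniform relative concentration of the form of `Z` around the form of `D`. -/
theorem uniform_concentration (hK : 2 ≤ K) (hS : S.PosSemidef)
    (ha : (Matrix.of fun (i : Fin d) (k : Fin K) => a k i).rank ≤ p) (hSp : S.rank ≤ p)
    (hlaw : ∀ k, HasLaw (ξ k) (multivariateGaussian 0 S) P) (hind : iIndepFun ξ P)
    {ε : ℝ} (hε : 0 < ε) (hε1 : ε ≤ 1 / 16) (hKε : 0 < p → 3 ≤ ε * (K - 1)) :
    P.real {ω | ¬ ∀ x : Fin d → ℝ,
        (1 - 8 * ε) * (x ⬝ᵥ (sampleCov a + S) *ᵥ x) ≤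
          x ⬝ᵥ noncentralCov a (fun k => ξ k ω) *ᵥ x ∧
        x ⬝ᵥ noncentralCov a (fun k => ξ k ω) *ᵥ x ≤
          (1 + 8 * ε) * (x ⬝ᵥ (sampleCov a + S) *ᵥ x)} ≤
      ((2 * p : ℕ) : ℝ) * (3 / ε) ^ (2 * p) * (6 * Real.exp (-(ε ^ 2 * (K - 1) / 144))) := by
  have hP : IsProbabilityMeasure P := hind.isProbabilityMeasure
  have hK2 : (2 : ℝ) ≤ K := by exact_mod_cast hK
  obtain ⟨L, hL, hrank⟩ := exists_linearMap_form ((posSemidef_sampleCov (by omega) a).add hS)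
  refine measure_compl_le_of_net L
    (fun ω => sampleMap (fun k => a k + deviation (fun k => ξ k ω) k)) ?_ hε (by linarith)
    (by positivity) (hrank.le.trans (rank_form_le ha hSp))
    (fun z => (1 - ε) * ((K - 1) * 1) ≤ ‖z‖ ^ 2 ∧ ‖z‖ ^ 2 ≤ (1 + ε) * ((K - 1) * 1)) ?_ _ ?_
  · intro x hx
    exact noise_vanishes_of_form_eq_zero hK hS hlaw (by rw [← hL, hx]; simp)
  · intro hp x hx
    simp_rw [norm_sampleMap_noncentral_sq]
    refine shifted_sample_concentration hK (fun k => hasLaw_dotProduct hS (hlaw k) x)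
      (iIndepFun_dotProduct hind x) _ hε (by linarith) one_pos ?_ (hKε (by omega))
    rw [sum_sq_add_variance hK hS, ← hL, hx, one_pow]
  · intro N ω hnet hker hgood x
    set B := sampleMap (fun k => a k + deviation (fun k => ξ k ω) k) with hB
    set c := √((K : ℝ) - 1) with hc
    have hc0 : 0 < c := Real.sqrt_pos.2 (by linarith)
    have hc2 : c ^ 2 = (K : ℝ) - 1 := Real.sq_sqrt (by linarith)
    have hup : ∀ x, ‖B x‖ ≤ (1 + ε) * c / (1 - ε) * ‖L x‖ := by
      refine norm_le_of_net L B hker (by linarith) (by positivity) hnet fun n hn => ?_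
      refine abs_le_of_sq_le_sq' ?_ (by positivity) |>.2
      rw [mul_pow, hc2]
      nlinarith [(hgood n hn).2]
    have hlow := le_norm_of_net L B (ε := ε) (R := (1 + ε) * c / (1 - ε)) (r := (1 - ε) * c)
      (div_nonneg (by positivity) (by linarith)) hnet (fun n hn => by
        refine abs_le_of_sq_le_sq' ?_ (norm_nonneg _) |>.2
        rw [mul_pow, hc2]
        nlinarith [(hgood n hn).1]) hup x
    -- On the level of norms the relative error is `5 ε / 2`, both ways; squaring turns it into at
    -- most `8 ε`.
    have hratio : (1 + ε) / (1 - ε) ≤ 1 + 5 / 2 * ε := by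
      rw [div_le_iff₀ (by linarith)]
      nlinarith
    have hR : (1 + ε) * c / (1 - ε) = (1 + ε) / (1 - ε) * c := by ring
    have hLx := norm_nonneg (L x)
    have h1 : ‖B x‖ ≤ (1 + 5 / 2 * ε) * (c * ‖L x‖) := by
      refine (hup x).trans ?_
      rw [hR, mul_assoc]
      gcongr
    have h2 : (1 - 5 / 2 * ε) * (c * ‖L x‖) ≤ ‖B x‖ := by
      refine le_trans ?_ hlow
      rw [hR, ← mul_assoc]
      gcongr
      have : (1 + ε) / (1 - ε) * c * ε ≤ (1 + 5 / 2 * ε) * c * ε := by gcongr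
      nlinarith [mul_pos hc0 hε]
    rw [noncentralCov_form_eq, ← hL, ← hc2]
    have h3 : ‖B x‖ ^ 2 ≤ ((1 + 5 / 2 * ε) * (c * ‖L x‖)) ^ 2 := by gcongr
    have h4 : ((1 - 5 / 2 * ε) * (c * ‖L x‖)) ^ 2 ≤ ‖B x‖ ^ 2 := by
      gcongr
      exact mul_nonneg (by linarith) (by positivity)
    have hpos : 0 ≤ (c * ‖L x‖) ^ 2 := sq_nonneg _
    constructor
    · rw [inv_mul_eq_div, le_div_iff₀ (by positivity)]
      refine le_trans ?_ h4
      rw [mul_pow]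
      have : 1 - 8 * ε ≤ (1 - 5 / 2 * ε) ^ 2 := by nlinarith
      calc _ = (1 - 8 * ε) * (c * ‖L x‖) ^ 2 := by ring
        _ ≤ _ := by gcongr
    · rw [inv_mul_eq_div, div_le_iff₀ (by positivity)]
      refine h3.trans ?_
      rw [mul_pow]
      have : (1 + 5 / 2 * ε) ^ 2 ≤ 1 + 8 * ε := by nlinarith
      calc _ ≤ (1 + 8 * ε) * (c * ‖L x‖) ^ 2 := by gcongr
        _ = _ := by ring

/-- Upper tail of the largest relative eigenvalue of `Z`. -/
theorem uniform_upper_tail (hK : 2 ≤ K) (hS : S.PosSemidef)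
    (ha : (Matrix.of fun (i : Fin d) (k : Fin K) => a k i).rank ≤ p) (hSp : S.rank ≤ p)
    (hlaw : ∀ k, HasLaw (ξ k) (multivariateGaussian 0 S) P) (hind : iIndepFun ξ P)
    (hKp : 100 * (p : ℝ) ≤ K) {t : ℝ} (ht : 0 ≤ t) :
    P.real {ω | ¬ ∀ x : Fin d → ℝ, x ⬝ᵥ noncentralCov a (fun k => ξ k ω) *ᵥ x ≤
          (8 + t) * (x ⬝ᵥ (sampleCov a + S) *ᵥ x)} ≤ Real.exp (-(1 / 25 * K * t)) := by
  have hP : IsProbabilityMeasure P := hind.isProbabilityMeasure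
  have hK2 : (2 : ℝ) ≤ K := by exact_mod_cast hK
  obtain ⟨L, hL, hrank⟩ := exists_linearMap_form ((posSemidef_sampleCov (by omega) a).add hS)
  -- Passing from a `1/8`-net to all vectors divides squared norms by `(7 / 8) ^ 2 = 49 / 64`.
  set u := (8 + t) * (49 / 64) with hu
  have key := measure_compl_le_of_net (P := P) L
    (fun ω => sampleMap (fun k => a k + deviation (fun k => ξ k ω) k))
    (fun x hx => noise_vanishes_of_form_eq_zero hK hS hlaw (by rw [← hL, hx]; simp))
    (ε := 1 / 8) (by norm_num) (by norm_num)
    (Real.exp_pos (3 * K / 8 - (u - 2) * (K - 1) / 8)).le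
    (hrank.le.trans (rank_form_le ha hSp))
    (fun z => ‖z‖ ^ 2 ≤ u * ((K - 1) * 1)) (fun hp x hx => by
      simp_rw [norm_sampleMap_noncentral_sq]
      refine shifted_sample_upper_tail hK (fun k => hasLaw_dotProduct hS (hlaw k) x)
        (iIndepFun_dotProduct hind x) _ one_pos ?_ u
      rw [sum_sq_add_variance hK hS, ← hL, hx, one_pow])
    (fun ω => ∀ x : Fin d → ℝ, x ⬝ᵥ noncentralCov a (fun k => ξ k ω) *ᵥ x ≤
          (8 + t) * (x ⬝ᵥ (sampleCov a + S) *ᵥ x)) (fun N ω hnet hker hgood x => by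
      set B := sampleMap (fun k => a k + deviation (fun k => ξ k ω) k) with hB
      have hu0 : 0 ≤ u * ((K : ℝ) - 1) := mul_nonneg (by positivity) (by linarith)
      have h1 := norm_le_of_net L B hker (by norm_num) (Real.sqrt_nonneg _) hnet
        (fun n hn => by
          refine abs_le_of_sq_le_sq' ?_ (Real.sqrt_nonneg (u * ((K : ℝ) - 1))) |>.2
          rw [Real.sq_sqrt hu0]
          simpa using hgood n hn) x
      have h2 : ‖B x‖ ^ 2 ≤ (√(u * ((K : ℝ) - 1)) / (1 - 1 / 8) * ‖L x‖) ^ 2 := by gcongr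
      rw [mul_pow, div_pow, Real.sq_sqrt hu0] at h2
      rw [noncentralCov_form_eq, ← hL, inv_mul_eq_div, div_le_iff₀ (by linarith)]
      refine h2.trans (le_of_eq ?_)
      rw [hu]
      ring)
  refine key.trans ?_
  rcases Nat.eq_zero_or_pos p with rfl | hp
  · simp only [mul_zero, Nat.cast_zero, zero_mul]
    positivity
  have hp1 : (1 : ℝ) ≤ p := by exact_mod_cast hp
  have e1 : ((2 * p : ℕ) : ℝ) ≤ Real.exp (2 * p) := by
    have := Real.add_one_le_exp (2 * (p : ℝ))
    push_cast
    linarith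
  have e2 : (3 / (1 / 8 : ℝ)) ^ (2 * p) ≤ Real.exp (8 * p) := by
    have h3 : (3 / (1 / 8 : ℝ)) ≤ Real.exp 4 := by
      have := Real.exp_one_gt_d9
      have h4 : Real.exp 4 = Real.exp 1 ^ 4 := by rw [← Real.exp_nat_mul]; norm_num
      rw [h4]
      calc (3 / (1 / 8) : ℝ) ≤ 2.7 ^ 4 := by norm_num
        _ ≤ _ := by gcongr; linarith
    calc (3 / (1 / 8 : ℝ)) ^ (2 * p) ≤ Real.exp 4 ^ (2 * p) := by gcongr
      _ = Real.exp (8 * p) := by rw [← Real.exp_nat_mul]; push_cast; ring_nf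
  calc ((2 * p : ℕ) : ℝ) * (3 / (1 / 8 : ℝ)) ^ (2 * p) *
        Real.exp (3 * K / 8 - (u - 2) * (K - 1) / 8)
      ≤ Real.exp (2 * p) * Real.exp (8 * p) * Real.exp (3 * K / 8 - (u - 2) * (K - 1) / 8) := by
        gcongr
    _ = Real.exp (2 * p + 8 * p + (3 * K / 8 - (u - 2) * (K - 1) / 8)) := by
        rw [Real.exp_add, Real.exp_add]
    _ ≤ _ := by
        -- At `t = 0` the tail gains `33 (K - 1) / 64`, which exceeds `3 K / 8` plus the net cost
        -- `10 p ≤ K / 10` because `K ≥ 100`.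
        rw [Real.exp_le_exp, hu]
        have : (K : ℝ) * t / 2 ≤ ((K : ℝ) - 1) * t := by nlinarith
        nlinarith

end Uniform

/-! ### Bounding the ratios by comparison of forms -/

section Ratios

open Matrix

variable {d : ℕ}

theorem loewner_of_forall {A B : Matrix (Fin d) (Fin d) ℝ} (hA : A.IsHermitian)
    (hB : B.IsHermitian) (h : ∀ x, x ⬝ᵥ A *ᵥ x ≤ x ⬝ᵥ B *ᵥ x) : Loewner A B := by
  refine PosSemidef.of_dotProduct_mulVec_nonneg (hB.sub hA) fun x => ?_
  rw [star_trivial, sub_mulVec, dotProduct_sub, sub_nonneg]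
  exact h x

theorem form_add_smul_one (A : Matrix (Fin d) (Fin d) ℝ) (ρ : ℝ) (x : Fin d → ℝ) :
    x ⬝ᵥ (A + ρ • (1 : Matrix (Fin d) (Fin d) ℝ)) *ᵥ x = x ⬝ᵥ A *ᵥ x + ρ * (x ⬝ᵥ x) := by
  rw [add_mulVec, dotProduct_add, smul_mulVec, one_mulVec, dotProduct_smul, smul_eq_mul]

theorem dotProduct_self_nonneg_real (x : Fin d → ℝ) : 0 ≤ x ⬝ᵥ x :=
  Finset.sum_nonneg fun i _ => mul_self_nonneg (x i)

theorem posDef_add_smul_one {A : Matrix (Fin d) (Fin d) ℝ} (hA : A.PosSemidef) {ρ : ℝ}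
    (hρ : 0 < ρ) : (A + ρ • (1 : Matrix (Fin d) (Fin d) ℝ)).PosDef :=
  PosDef.posSemidef_add hA (PosDef.one.smul hρ)

theorem upperRatio_le {D Z : Matrix (Fin d) (Fin d) ℝ} (hD : D.PosSemidef) (hZ : Z.PosSemidef)
    {ρ r : ℝ} (hρ : 0 < ρ) (hr : 0 ≤ r) (h : ∀ x, x ⬝ᵥ Z *ᵥ x ≤ r * (x ⬝ᵥ D *ᵥ x)) :
    upperRatio ρ D Z ≤ r := by
  refine csInf_le ⟨0, fun s hs => hs.1⟩ ⟨hr, ?_⟩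
  refine loewner_of_forall hZ.1 ((posDef_add_smul_one hD hρ).1.smul (star_trivial r)) fun x => ?_
  rw [smul_mulVec, dotProduct_smul, form_add_smul_one, smul_eq_mul, mul_add]
  have : 0 ≤ r * (ρ * (x ⬝ᵥ x)) := by have := dotProduct_self_nonneg_real x; positivity
  linarith [h x]

/-- Inversion reverses the Loewner order, up to a factor. -/
theorem loewner_inv_of_forall {A M : Matrix (Fin d) (Fin d) ℝ} (hA : A.PosDef) (hM : M.PosDef)
    {r : ℝ} (hr : 0 < r) (h : ∀ x, x ⬝ᵥ A *ᵥ x ≤ r * (x ⬝ᵥ M *ᵥ x)) : Loewner M⁻¹ (r • A⁻¹) := by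
  refine loewner_of_forall hM.inv.1 (hA.inv.1.smul (star_trivial r)) fun x => ?_
  have hAdet : IsUnit A.det := (isUnit_iff_isUnit_det A).1 hA.isUnit
  have hMdet : IsUnit M.det := (isUnit_iff_isUnit_det M).1 hM.isUnit
  set y := M⁻¹ *ᵥ x with hy
  set z := A⁻¹ *ᵥ x with hz
  have hMy : M *ᵥ y = x := by rw [hy, mulVec_mulVec, mul_nonsing_inv _ hMdet, one_mulVec]
  have hAz : A *ᵥ z = x := by rw [hz, mulVec_mulVec, mul_nonsing_inv _ hAdet, one_mulVec]
  have h1 := h y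
  rw [hMy] at h1
  have hsymm : z ⬝ᵥ A *ᵥ y = x ⬝ᵥ y := by
    rw [dotProduct_mulVec, ← mulVec_transpose,
      show Aᵀ = A by rw [← conjTranspose_eq_transpose_of_trivial]; exact hA.1, hAz]
  -- Expanding gives `2 r xᵀy ≤ yᵀAy + r² xᵀz`, and `yᵀAy ≤ r xᵀy` by hypothesis.
  have h2 := dotProduct_mulVec_nonneg hA.posSemidef (y - r • z)
  rw [mulVec_sub, mulVec_smul, hAz, dotProduct_sub, sub_dotProduct, sub_dotProduct,
    smul_dotProduct, smul_dotProduct, dotProduct_smul, dotProduct_smul, hsymm,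
    dotProduct_comm y x, dotProduct_comm z x] at h2
  simp only [smul_eq_mul] at h2
  rw [dotProduct_comm y x] at h1
  rw [smul_mulVec, dotProduct_smul, smul_eq_mul, ← hz]
  have h3 : r * (x ⬝ᵥ y) ≤ r * (r * (x ⬝ᵥ z)) := by linarith
  exact le_of_mul_le_mul_left h3 hr

theorem inverseRatio_le {D Z : Matrix (Fin d) (Fin d) ℝ} (hD : D.PosSemidef) (hZ : Z.PosSemidef)
    {ρ r : ℝ} (hρ : 0 < ρ) (hr : 0 < r)
    (h : ∀ x, x ⬝ᵥ D *ᵥ x + ρ * (x ⬝ᵥ x) ≤ r * (x ⬝ᵥ Z *ᵥ x + ρ * (x ⬝ᵥ x))) :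
    inverseRatio ρ D Z ≤ r := by
  refine csInf_le ⟨0, fun s hs => hs.1⟩ ⟨hr.le, ?_⟩
  refine loewner_inv_of_forall (posDef_add_smul_one hD hρ) (posDef_add_smul_one hZ hρ) hr
    fun x => ?_
  rw [form_add_smul_one, form_add_smul_one]
  exact h x

theorem inverseRatio_nonneg (ρ : ℝ) (D Z : Matrix (Fin d) (Fin d) ℝ) :
    0 ≤ inverseRatio ρ D Z := Real.sInf_nonneg fun _ h => h.1

/-- Submultiplicativity gives `1 = ‖A A⁻¹‖ ≤ ‖A‖ ‖A⁻¹‖`; for `d = 0` the norms vanish and `log 0 =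
0`. -/
theorem log_condNumber_nonneg {A : Matrix (Fin d) (Fin d) ℝ} (hA : IsUnit A) :
    0 ≤ Real.log (condNumber A) := by
  rcases Nat.eq_zero_or_pos d with rfl | hd
  · have : condNumber A = 0 := by
      rw [condNumber, opNorm, ContinuousLinearMap.opNorm_subsingleton, zero_mul]
    rw [this, Real.log_zero]
  · have : Nonempty (Fin d) := ⟨⟨0, hd⟩⟩
    refine Real.log_nonneg ?_
    rw [condNumber, opNorm, opNorm]
    refine le_trans ?_ (norm_mul_le _ _)
    rw [← map_mul, mul_nonsing_inv _ ((isUnit_iff_isUnit_det A).1 hA), map_one, norm_one]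

theorem form_le_opNorm (A : Matrix (Fin d) (Fin d) ℝ) (x : Fin d → ℝ) :
    x ⬝ᵥ A *ᵥ x ≤ opNorm A * (x ⬝ᵥ x) := by
  have h1 := real_inner_le_norm (WithLp.toLp 2 x) (toEuclideanCLM (𝕜 := ℝ) A (WithLp.toLp 2 x))
  have h2 := (toEuclideanCLM (𝕜 := ℝ) A).le_opNorm (WithLp.toLp 2 x)
  have h3 : inner ℝ (WithLp.toLp 2 x) (toEuclideanCLM (𝕜 := ℝ) A (WithLp.toLp 2 x)) =
      x ⬝ᵥ A *ᵥ x := by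
    rw [inner_toEuclideanCLM]
  have h4 : x ⬝ᵥ x = ‖WithLp.toLp 2 x‖ * ‖WithLp.toLp 2 x‖ := by
    rw [← sq, EuclideanSpace.norm_sq_eq]
    simp [dotProduct, sq]
  rw [h3] at h1
  rw [h4, opNorm]
  nlinarith [norm_nonneg (WithLp.toLp 2 x)]

end Ratios

/-! ### Summation over layers -/

section Layers

/-- Integration over a set, with the integrand controlled on the layers between decreasing sets. -/
theorem setLIntegral_le_of_layers {Ω : Type*} [MeasurableSpace Ω] (P : Measure Ω)
    (U : Set Ω) (T : ℕ → Set Ω) (f : Ω → ENNReal) (b₀ : ENNReal) (b : ℕ → ENNReal)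
    (h0 : ∀ ω, ω ∉ T 0 → f ω ≤ b₀) (hb : ∀ i ω, ω ∈ T i → ω ∉ T (i + 1) → f ω ≤ b i)
    (hT : ∀ ω, ∃ i, ω ∉ T i) :
    ∫⁻ ω in U, f ω ∂P ≤ b₀ * P U + ∑' i, b i * P (T i) := by
  classical
  -- The sets `T i` need not be measurable; their measurable hulls make the majorant measurable
  -- without changing the measures. The first `T i` that misses `ω` selects the layer.
  have hle : ∀ ω, f ω ≤ b₀ + ∑' i, (toMeasurable P (T i)).indicator (fun _ => b i) ω := by
    intro ω
    rcases h : Nat.find (hT ω) with _ | i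
    · have h1 := Nat.find_spec (hT ω)
      rw [h] at h1
      exact (h0 ω h1).trans le_self_add
    · have h1 := Nat.find_spec (hT ω)
      rw [h] at h1
      have h2 : ω ∈ T i := not_not.1 (Nat.find_min (hT ω) (by omega : i < _))
      refine (hb i ω h2 h1).trans (le_trans ?_ le_add_self)
      refine le_trans ?_ (ENNReal.le_tsum i)
      rw [Set.indicator_of_mem (subset_toMeasurable P _ h2)]
  calc ∫⁻ ω in U, f ω ∂P
      ≤ ∫⁻ ω in U, (b₀ + ∑' i, (toMeasurable P (T i)).indicator (fun _ => b i) ω) ∂P :=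
        lintegral_mono hle
    _ = b₀ * P U + ∑' i, b i * P (toMeasurable P (T i) ∩ U) := by
        rw [lintegral_add_left measurable_const, lintegral_const, Measure.restrict_apply_univ,
          lintegral_tsum fun i =>
            (measurable_const.indicator (measurableSet_toMeasurable P _)).aemeasurable]
        congr 2 with i
        rw [lintegral_indicator_const (measurableSet_toMeasurable P _),
          Measure.restrict_apply (measurableSet_toMeasurable P _)]
    _ ≤ _ := by
        refine add_le_add le_rfl (ENNReal.tsum_le_tsum fun i => mul_le_mul_right ?_ (b i))
        exact (measure_mono Set.inter_subset_left).trans (measure_toMeasurable (T i)).le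

end Layers

/-! ### The mean of `Z` -/

section Mean

variable {Ω : Type*} [MeasurableSpace Ω] {P : Measure Ω} {d K : ℕ}
  {S : Matrix (Fin d) (Fin d) ℝ}

/-- The polarised form of `sum_add_centered_sq`, needed for the off-diagonal entries. -/
theorem sum_add_centered_mul (hK : 0 < K) (y y' e e' : Fin K → ℝ) :
    ∑ k, (y k + (e k - (K : ℝ)⁻¹ * ∑ j, e j)) * (y' k + (e' k - (K : ℝ)⁻¹ * ∑ j, e' j)) =
      ∑ k, y k * y' k + ∑ k, (y k - (K : ℝ)⁻¹ * ∑ j, y j) * e' k +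
        ∑ k, (y' k - (K : ℝ)⁻¹ * ∑ j, y' j) * e k + ∑ k, e k * e' k -
        (K : ℝ)⁻¹ * ∑ k, ∑ l, e k * e' l := by
  have hK' : (K : ℝ) ≠ 0 := by positivity
  rw [← Finset.sum_mul_sum]
  set m := (K : ℝ)⁻¹ * ∑ j, e j with hm
  set m' := (K : ℝ)⁻¹ * ∑ j, e' j with hm'
  set z := (K : ℝ)⁻¹ * ∑ j, y j with hz
  set z' := (K : ℝ)⁻¹ * ∑ j, y' j with hz'
  have hes : ∑ j, e j = K * m := by rw [hm]; field_simp
  have hes' : ∑ j, e' j = K * m' := by rw [hm']; field_simp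
  have hys : ∑ j, y j = K * z := by rw [hz]; field_simp
  have hys' : ∑ j, y' j = K * z' := by rw [hz']; field_simp
  have h1 : ∀ k, (y k + (e k - m)) * (y' k + (e' k - m')) =
      y k * y' k + (y k - z) * e' k + (y' k - z') * e k + e k * e' k + z * e' k + z' * e k
        - m' * y k - m * y' k - m' * e k - m * e' k + m * m' := fun k => by ring
  simp_rw [h1]
  simp only [Finset.sum_add_distrib, Finset.sum_sub_distrib, ← Finset.mul_sum, Finset.sum_const,
    Finset.card_univ, Fintype.card_fin, nsmul_eq_mul, hes, hys, hes', hys']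
  field_simp
  ring

theorem noncentralCov_apply (hK : 0 < K) (a z : Fin K → EuclideanSpace ℝ (Fin d)) (i j : Fin d) :
    noncentralCov a z i j = ((K : ℝ) - 1)⁻¹ *
      (∑ k, a k i * a k j + ∑ k, (a k i - (K : ℝ)⁻¹ * ∑ l, a l i) * z k j +
        ∑ k, (a k j - (K : ℝ)⁻¹ * ∑ l, a l j) * z k i + ∑ k, z k i * z k j -
        (K : ℝ)⁻¹ * ∑ k, ∑ l, z k i * z l j) := by
  rw [← sum_add_centered_mul hK]
  simp [noncentralCov, sampleCov, deviation, Matrix.sum_apply, Matrix.vecMulVec_apply]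

variable {ξ : Fin K → Ω → EuclideanSpace ℝ (Fin d)}

theorem memLp_coordinate {X : Ω → EuclideanSpace ℝ (Fin d)}
    (hX : HasLaw X (multivariateGaussian 0 S) P) (i : Fin d) : MemLp (fun ω => X ω i) 2 P := by
  have h : MemLp (fun y : EuclideanSpace ℝ (Fin d) => y i) 2 (multivariateGaussian 0 S) :=
    IsGaussian.memLp_dual (multivariateGaussian 0 S) (EuclideanSpace.proj i) 2 (by simp)
  rw [← hX.map_eq] at h
  exact (memLp_map_measure_iff h.1 hX.aemeasurable).1 h

theorem integral_coordinate {X : Ω → EuclideanSpace ℝ (Fin d)}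
    (hX : HasLaw X (multivariateGaussian 0 S) P) (i : Fin d) : ∫ ω, X ω i ∂P = 0 := by
  have h : ∫ y : EuclideanSpace ℝ (Fin d), y i ∂(multivariateGaussian 0 S) = 0 := by
    have := ContinuousLinearMap.integral_comp_id_comm (μ := multivariateGaussian 0 S)
      IsGaussian.integrable_id (EuclideanSpace.proj (𝕜 := ℝ) i)
    rw [integral_id_multivariateGaussian] at this
    simpa using this
  rw [← hX.map_eq, integral_map hX.aemeasurable (by fun_prop)] at h
  exact h

theorem integral_coordinate_mul (hS : S.PosSemidef)
    (hlaw : ∀ k, HasLaw (ξ k) (multivariateGaussian 0 S) P) (hind : iIndepFun ξ P)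
    (k l : Fin K) (i j : Fin d) :
    Integrable (fun ω => ξ k ω i * ξ l ω j) P ∧
      ∫ ω, ξ k ω i * ξ l ω j ∂P = if k = l then S i j else 0 := by
  have hP : IsProbabilityMeasure P := hind.isProbabilityMeasure
  have hi := memLp_coordinate (hlaw k) i
  have hj := memLp_coordinate (hlaw l) j
  refine ⟨hi.integrable_mul hj, ?_⟩
  have hcov := covariance_eq_sub hi hj
  simp only [integral_coordinate (hlaw k) i, zero_mul, sub_zero] at hcov
  have hcov' : ∫ ω, ξ k ω i * ξ l ω j ∂P = cov[fun ω => ξ k ω i, fun ω => ξ l ω j; P] := hcov.symm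
  rw [hcov']
  split_ifs with hkl
  · subst hkl
    rw [← covariance_eval_multivariateGaussian (μ := 0) hS, ← (hlaw k).map_eq,
      covariance_map (by fun_prop) (by fun_prop) (hlaw k).aemeasurable]
    rfl
  · refine IndepFun.covariance_eq_zero ?_ hi hj
    exact (hind.indepFun hkl).comp (φ := fun y : EuclideanSpace ℝ (Fin d) => y i)
      (ψ := fun y : EuclideanSpace ℝ (Fin d) => y j) (by fun_prop) (by fun_prop)

theorem integral_add_add_sub [IsProbabilityMeasure P] {f g h q : Ω → ℝ} (hf : Integrable f P)
    (hg : Integrable g P) (hh : Integrable h P) (hq : Integrable q P) (b c : ℝ) :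
    Integrable (fun ω => b + f ω + g ω + h ω - c * q ω) P ∧
      ∫ ω, (b + f ω + g ω + h ω - c * q ω) ∂P =
        b + ∫ ω, f ω ∂P + ∫ ω, g ω ∂P + ∫ ω, h ω ∂P - c * ∫ ω, q ω ∂P := by
  have i1 : Integrable (fun ω => b + f ω) P := (integrable_const b).add hf
  have i2 : Integrable (fun ω => b + f ω + g ω) P := i1.add hg
  have i3 : Integrable (fun ω => b + f ω + g ω + h ω) P := i2.add hh
  have i4 : Integrable (fun ω => c * q ω) P := hq.const_mul c
  refine ⟨i3.sub i4, ?_⟩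
  rw [integral_sub i3 i4, integral_add i2 hh, integral_add i1 hg,
    integral_add (integrable_const b) hf, integral_const_mul]
  simp

/-- `Z` is integrable with mean `D`. -/
theorem integral_noncentralCov (hK : 2 ≤ K) (hS : S.PosSemidef)
    (hlaw : ∀ k, HasLaw (ξ k) (multivariateGaussian 0 S) P) (hind : iIndepFun ξ P)
    (a : Fin K → EuclideanSpace ℝ (Fin d)) (i j : Fin d) :
    Integrable (fun ω => noncentralCov a (fun k => ξ k ω) i j) P ∧
      ∫ ω, noncentralCov a (fun k => ξ k ω) i j ∂P = (sampleCov a + S) i j := by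
  have hP : IsProbabilityMeasure P := hind.isProbabilityMeasure
  have hK2 : (2 : ℝ) ≤ K := by exact_mod_cast hK
  have hK0 : 0 < K := by omega
  simp_rw [noncentralCov_apply hK0]
  have hm := fun k l => integral_coordinate_mul hS hlaw hind k l i j
  have hc : ∀ k i, Integrable (fun ω => ξ k ω i) P := fun k i =>
    (memLp_coordinate (hlaw k) i).integrable one_le_two
  have i1 : Integrable (fun ω => ∑ k, (a k i - (K : ℝ)⁻¹ * ∑ l, a l i) * ξ k ω j) P :=
    integrable_finsetSum _ fun k _ => (hc k j).const_mul _
  have i2 : Integrable (fun ω => ∑ k, (a k j - (K : ℝ)⁻¹ * ∑ l, a l j) * ξ k ω i) P :=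
    integrable_finsetSum _ fun k _ => (hc k i).const_mul _
  have i3 : Integrable (fun ω => ∑ k, ξ k ω i * ξ k ω j) P :=
    integrable_finsetSum _ fun k _ => (hm k k).1
  have i4' : ∀ k, Integrable (fun ω => ∑ l, ξ k ω i * ξ l ω j) P := fun k =>
    integrable_finsetSum _ fun l _ => (hm k l).1
  have i4 : Integrable (fun ω => ∑ k, ∑ l, ξ k ω i * ξ l ω j) P :=
    integrable_finsetSum _ fun k _ => i4' k
  obtain ⟨hI, hE⟩ := integral_add_add_sub i1 i2 i3 i4 (∑ k, a k i * a k j) (K : ℝ)⁻¹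
  refine ⟨hI.const_mul _, ?_⟩
  rw [integral_const_mul, hE, integral_finsetSum _ (fun k _ => (hc k j).const_mul _),
    integral_finsetSum _ (fun k _ => (hc k i).const_mul _),
    integral_finsetSum _ (fun k _ => (hm k k).1), integral_finsetSum _ (fun k _ => i4' k)]
  simp_rw [integral_finsetSum _ (fun l _ => (hm _ l).1), integral_const_mul, (hm _ _).2,
    integral_coordinate (hlaw _)]
  -- The noise terms leave `K S - K⁻¹ K S = (K - 1) S`, which the normalisation turns into `S`.
  have : (K : ℝ) - 1 ≠ 0 := by linarith
  simp [sampleCov, Matrix.sum_apply, Matrix.vecMulVec_apply]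
  field_simp
  ring

end Mean

/-! ### The rare event, moments of `μ` and tail of `λ` -/

section RareEvent

open Matrix

variable {Ω : Type*} [MeasurableSpace Ω] {P : Measure Ω} {d K p : ℕ}
  {S : Matrix (Fin d) (Fin d) ℝ} {a : Fin K → EuclideanSpace ℝ (Fin d)}
  {ξ : Fin K → Ω → EuclideanSpace ℝ (Fin d)}

/-- Uniform concentration of the forms bounds both ratios. -/
theorem rareEvent_subset {Ω : Type*} {ξ : Fin K → Ω → EuclideanSpace ℝ (Fin d)} (hK : 2 ≤ K) (hS : S.PosSemidef) {δ δ' ρ : ℝ} (hρ : 0 < ρ)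
    (hδ' : 0 < δ') (hδ'1 : δ' ≤ 1 / 2) (hδ : δ' ≤ δ) :
    rareEvent δ ρ a S ξ ⊆ {ω | ¬ ∀ x : Fin d → ℝ,
        (1 - δ') * (x ⬝ᵥ (sampleCov a + S) *ᵥ x) ≤
          x ⬝ᵥ noncentralCov a (fun k => ξ k ω) *ᵥ x ∧
        x ⬝ᵥ noncentralCov a (fun k => ξ k ω) *ᵥ x ≤
          (1 + δ') * (x ⬝ᵥ (sampleCov a + S) *ᵥ x)} := by
  intro ω hω hgood
  have hD := (posSemidef_sampleCov (by omega) a).add hS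
  have hZ : (noncentralCov a (fun k => ξ k ω)).PosSemidef := posSemidef_sampleCov (by omega) _
  rcases hω with h | h
  · refine h.not_ge (upperRatio_le hD hZ hρ (by linarith) fun x => (hgood x).2.trans ?_)
    have := dotProduct_mulVec_nonneg hD x
    gcongr
    linarith
  · refine h.not_ge (inverseRatio_le hD hZ hρ (by linarith) fun x => ?_)
    have h1 := dotProduct_mulVec_nonneg hD x
    have h2 : 0 ≤ ρ * (x ⬝ᵥ x) := mul_nonneg hρ.le (dotProduct_self_nonneg_real x)
    -- From `1 - δ' ≥ 1 / 2` and `δ' ≤ δ`: `5 δ (1 - δ') ≥ 5 δ / 2 ≥ δ'`.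
    have h3 : 1 ≤ (1 + 5 * δ) * (1 - δ') := by nlinarith
    calc x ⬝ᵥ (sampleCov a + S) *ᵥ x + ρ * (x ⬝ᵥ x)
        ≤ (1 + 5 * δ) * (1 - δ') * (x ⬝ᵥ (sampleCov a + S) *ᵥ x) +
          (1 + 5 * δ) * (ρ * (x ⬝ᵥ x)) := by
          refine add_le_add (le_mul_of_one_le_left h1 h3) (le_mul_of_one_le_left h2 ?_)
          linarith
      _ = (1 + 5 * δ) * ((1 - δ') * (x ⬝ᵥ (sampleCov a + S) *ᵥ x) + ρ * (x ⬝ᵥ x)) := by ring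
      _ ≤ _ := by
          gcongr
          · linarith
          · exact (hgood x).1

/-- The signal is controlled by the sample and the noise. -/
theorem sampleCov_form_le (hK : 2 ≤ K) (z : Fin K → EuclideanSpace ℝ (Fin d)) (x : Fin d → ℝ) :
    x ⬝ᵥ sampleCov a *ᵥ x ≤
      2 * (x ⬝ᵥ noncentralCov a z *ᵥ x) + 2 * (x ⬝ᵥ noncentralCov 0 z *ᵥ x) := by
  have hK2 : (2 : ℝ) ≤ K := by exact_mod_cast hK
  have hinv : 0 ≤ ((K : ℝ) - 1)⁻¹ := inv_nonneg.2 (by linarith)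
  rw [dotProduct_sampleCov, dotProduct_noncentralCov, dotProduct_noncentralCov, mul_left_comm 2,
    mul_left_comm 2, ← mul_add]
  refine mul_le_mul_of_nonneg_left ?_ hinv
  generalize (K : ℝ)⁻¹ * ∑ j, x ⬝ᵥ (z j).ofLp = m
  rw [Finset.mul_sum, Finset.mul_sum, ← Finset.sum_add_distrib]
  refine Finset.sum_le_sum fun k _ => ?_
  simp only [Pi.zero_apply, WithLp.ofLp_zero, dotProduct_zero, zero_add]
  set e := x ⬝ᵥ (z k).ofLp - m
  nlinarith [sq_nonneg (x ⬝ᵥ (a k).ofLp + 2 * e)]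

/-- A bound of the noise covariance bounds the inverse ratio. -/
theorem inverseRatio_le_of_noise (hK : 2 ≤ K) (hS : S.PosSemidef) {ρ q : ℝ} (hρ : 0 < ρ)
    (hρS : ρ ≤ opNorm S) (hq : 0 ≤ q) (z : Fin K → EuclideanSpace ℝ (Fin d))
    (hz : ∀ x : Fin d → ℝ, x ⬝ᵥ noncentralCov 0 z *ᵥ x ≤ q * (opNorm S * (x ⬝ᵥ x))) :
    inverseRatio ρ (sampleCov a + S) (noncentralCov a z) ≤ (2 * q + 2) * (opNorm S / ρ) := by
  have hD := (posSemidef_sampleCov (by omega) a).add hS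
  have hZ : (noncentralCov a z).PosSemidef := posSemidef_sampleCov (by omega) _
  have hR : 1 ≤ opNorm S / ρ := by rwa [le_div_iff₀ hρ, one_mul]
  refine inverseRatio_le hD hZ hρ (by positivity) fun x => ?_
  have h1 := sampleCov_form_le (a := a) hK z x
  have h2 := hz x
  have h3 := form_le_opNorm S x
  have h4 := dotProduct_mulVec_nonneg hZ x
  have hx := dotProduct_self_nonneg_real x
  have h5 : ρ * (x ⬝ᵥ x) ≤ opNorm S * (x ⬝ᵥ x) := by gcongr
  -- The form of `Z` needs only the factor `2`. The larger factor serves the identity part, where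
  -- `ρ` must absorb `2 q ‖S‖` from the signal, `‖S‖` from the noise and `ρ ≤ ‖S‖`.
  have h6 : 2 * (x ⬝ᵥ noncentralCov a z *ᵥ x) ≤
      (2 * q + 2) * (opNorm S / ρ) * (x ⬝ᵥ noncentralCov a z *ᵥ x) := by
    gcongr
    nlinarith
  have h7 : (2 * q + 2) * (opNorm S / ρ) * (ρ * (x ⬝ᵥ x)) =
      (2 * q + 2) * (opNorm S * (x ⬝ᵥ x)) := by field_simp
  rw [mul_add, h7, add_mulVec, dotProduct_add]
  linarith

/-- The constant in the moment bound. -/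
noncomputable def momentConst (n : ℕ) : ℝ :=
  20 ^ n + ∑' i : ℕ, (22 * ((i : ℝ) + 1)) ^ n * Real.exp (-(1 / 25) * ((i : ℝ) + 1))

theorem summable_momentConst (n : ℕ) :
    Summable fun i : ℕ => (22 * ((i : ℝ) + 1)) ^ n * Real.exp (-(1 / 25) * ((i : ℝ) + 1)) := by
  have h := Real.summable_pow_mul_exp_neg_nat_mul n (r := 1 / 25) (by norm_num)
  have h1 := ((summable_nat_add_iff 1).2 h).mul_left ((22 : ℝ) ^ n)
  refine h1.congr fun i => ?_
  push_cast
  rw [mul_pow]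
  ring

theorem momentConst_pos (n : ℕ) : 0 < momentConst n := by
  have : 0 ≤ ∑' i : ℕ, (22 * ((i : ℝ) + 1)) ^ n * Real.exp (-(1 / 25) * ((i : ℝ) + 1)) :=
    tsum_nonneg fun i => by positivity
  rw [momentConst]
  positivity

/-- Moments of the inverse ratio over an event. -/
theorem moment_bound (hK : 2 ≤ K) (hS : S.PosSemidef) (hSp : S.rank ≤ p)
    (hlaw : ∀ k, HasLaw (ξ k) (multivariateGaussian 0 S) P) (hind : iIndepFun ξ P)
    (hKp : 100 * (p : ℝ) ≤ K) {ρ : ℝ} (hρ : 0 < ρ) (hρS : ρ ≤ opNorm S) (U : Set Ω) {β : ℝ}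
    (hU : P.real U ≤ β) (hβ : Real.exp (-(1 / 50 * K)) ≤ β) (n : ℕ) :
    ∫⁻ ω in U, ENNReal.ofReal (inverseRatio ρ (sampleCov a + S)
        (noncentralCov a fun k => ξ k ω) ^ n) ∂P ≤
      ENNReal.ofReal (momentConst n * (opNorm S / ρ) ^ n * β) := by
  have hP : IsProbabilityMeasure P := hind.isProbabilityMeasure
  have hK2 : (2 : ℝ) ≤ K := by exact_mod_cast hK
  have hσ : 0 < opNorm S := hρ.trans_le hρS
  set R := opNorm S / ρ with hR
  have hR0 : 0 < R := by positivity
  have hβ0 : 0 < β := (Real.exp_pos _).trans_le hβ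
  -- Layers of the pure noise covariance: taking `a = 0` makes `D = S`, so the upper tail applies to
  -- `T i` with `t = i + 1`.
  set T : ℕ → Set Ω := fun i => {ω | ¬ ∀ x : Fin d → ℝ,
    x ⬝ᵥ noncentralCov 0 (fun k => ξ k ω) *ᵥ x ≤
      (8 + ((i : ℝ) + 1)) * (opNorm S * (x ⬝ᵥ x))} with hT
  have hTP : ∀ i, P (T i) ≤ ENNReal.ofReal (Real.exp (-(1 / 25 * K * ((i : ℝ) + 1)))) := by
    intro i
    have h0 : sampleCov (0 : Fin K → EuclideanSpace ℝ (Fin d)) = 0 := by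
      ext; simp [sampleCov]
    have ha0 : (Matrix.of fun (i : Fin d) (k : Fin K) =>
        (0 : Fin K → EuclideanSpace ℝ (Fin d)) k i).rank ≤ p := by
      have : (Matrix.of fun (i : Fin d) (k : Fin K) =>
        (0 : Fin K → EuclideanSpace ℝ (Fin d)) k i) = 0 := by ext; simp
      rw [this, rank_zero]
      exact Nat.zero_le _
    have h := uniform_upper_tail hK hS ha0 hSp hlaw hind hKp (t := (i : ℝ) + 1) (by positivity)
    rw [h0, zero_add] at h
    rw [← ofReal_measureReal]
    refine ENNReal.ofReal_le_ofReal ((measureReal_mono ?_).trans h)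
    intro ω hω hcon
    refine hω fun x => (hcon x).trans ?_
    have := form_le_opNorm S x
    gcongr
  have hf : ∀ (i : ℕ) ω, ω ∉ T i → inverseRatio ρ (sampleCov a + S)
      (noncentralCov a fun k => ξ k ω) ^ n ≤ (2 * (8 + ((i : ℝ) + 1)) + 2) ^ n * R ^ n := by
    intro i ω hω
    rw [← mul_pow]
    refine pow_le_pow_left₀ (inverseRatio_nonneg _ _ _) ?_ n
    exact inverseRatio_le_of_noise hK hS hρ hρS (by positivity) _ (not_not.1 hω)
  -- Outside `T 0` the factor `2 q + 2` is `20`; outside `T (i + 1)` it is `2 i + 22 ≤ 22 (i + 1)`.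
  have hlayer := setLIntegral_le_of_layers P U T
    (fun ω => ENNReal.ofReal (inverseRatio ρ (sampleCov a + S)
        (noncentralCov a fun k => ξ k ω) ^ n)) (ENNReal.ofReal (20 ^ n * R ^ n))
    (fun i => ENNReal.ofReal ((22 * ((i : ℝ) + 1)) ^ n * R ^ n))
    (fun ω hω => ENNReal.ofReal_le_ofReal ((hf 0 ω hω).trans (by norm_num)))
    (fun i ω _ hω => ENNReal.ofReal_le_ofReal ((hf (i + 1) ω hω).trans (by
      push_cast
      gcongr
      have : (0 : ℝ) ≤ i := Nat.cast_nonneg i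
      linarith)))
    (fun ω => by
      obtain ⟨i, hi⟩ := exists_nat_gt (opNorm (noncentralCov 0 fun k => ξ k ω) / opNorm S)
      refine ⟨i, not_not.2 fun x => (form_le_opNorm _ x).trans ?_⟩
      rw [← mul_assoc]
      have hx := dotProduct_self_nonneg_real x
      gcongr
      rw [div_lt_iff₀ hσ] at hi
      nlinarith)
  refine hlayer.trans ?_
  have hsum := summable_momentConst n
  have hfirst : ENNReal.ofReal (20 ^ n * R ^ n) * P U ≤
      ENNReal.ofReal (20 ^ n * R ^ n * β) := by
    rw [← ofReal_measureReal, ← ENNReal.ofReal_mul (by positivity)]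
    gcongr
  have hterm : ∀ i : ℕ, ENNReal.ofReal ((22 * ((i : ℝ) + 1)) ^ n * R ^ n) * P (T i) ≤
      ENNReal.ofReal (R ^ n * β *
        ((22 * ((i : ℝ) + 1)) ^ n * Real.exp (-(1 / 25) * ((i : ℝ) + 1)))) := by
    intro i
    refine (mul_le_mul_right (hTP i) _).trans ?_
    rw [← ENNReal.ofReal_mul (by positivity)]
    refine ENNReal.ofReal_le_ofReal ?_
    -- Half of the exponent pays for `β`; the other half, by `K ≥ 2`, gives a summable factor free
    -- of `K`.
    have hexp : Real.exp (-(1 / 25 * K * ((i : ℝ) + 1))) ≤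
        β * Real.exp (-(1 / 25) * ((i : ℝ) + 1)) := by
      refine le_trans ?_ (mul_le_mul_of_nonneg_right hβ (Real.exp_pos _).le)
      rw [← Real.exp_add, Real.exp_le_exp]
      have : (0 : ℝ) ≤ i := Nat.cast_nonneg i
      nlinarith
    calc (22 * ((i : ℝ) + 1)) ^ n * R ^ n * Real.exp (-(1 / 25 * K * ((i : ℝ) + 1)))
        ≤ (22 * ((i : ℝ) + 1)) ^ n * R ^ n * (β * Real.exp (-(1 / 25) * ((i : ℝ) + 1))) := by
          gcongr
      _ = _ := by ring
  refine (add_le_add hfirst (ENNReal.tsum_le_tsum hterm)).trans ?_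
  rw [← ENNReal.ofReal_tsum_of_nonneg (fun i => by positivity) (hsum.mul_left _),
    ← ENNReal.ofReal_add (by positivity) (tsum_nonneg fun i => by positivity), tsum_mul_left]
  refine ENNReal.ofReal_le_ofReal (le_of_eq ?_)
  rw [momentConst]
  ring

/-- Probability of the rare event, for small relative deviations. -/
theorem rareEvent_le (hK : 2 ≤ K) (hS : S.PosSemidef)
    (ha : (Matrix.of fun (i : Fin d) (k : Fin K) => a k i).rank ≤ p) (hSp : S.rank ≤ p)
    (hlaw : ∀ k, HasLaw (ξ k) (multivariateGaussian 0 S) P) (hind : iIndepFun ξ P)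
    {ρ δ ε : ℝ} (hρ : 0 < ρ) (hε : 0 < ε) (hε1 : ε ≤ 1 / 16) (hδ : 8 * ε ≤ δ)
    (hKε : 0 < p → 3 ≤ ε * (K - 1)) :
    P.real (rareEvent δ ρ a S ξ) ≤
      Real.exp ((100 + 2 * Real.log (3 / ε)) * p - ε ^ 2 / 144 * K) := by
  have hP : IsProbabilityMeasure P := hind.isProbabilityMeasure
  refine (measureReal_mono (rareEvent_subset hK hS hρ (δ' := 8 * ε) (by linarith) (by linarith)
    hδ)).trans ((uniform_concentration hK hS ha hSp hlaw hind hε hε1 hKε).trans ?_)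
  rcases Nat.eq_zero_or_pos p with rfl | hp
  · simp only [mul_zero, Nat.cast_zero, zero_mul]
    positivity
  have hp1 : (1 : ℝ) ≤ p := by exact_mod_cast hp
  have e1 : ((2 * p : ℕ) : ℝ) ≤ Real.exp (2 * p) := by
    have := Real.add_one_le_exp (2 * (p : ℝ))
    push_cast
    linarith
  have e2 : (3 / ε) ^ (2 * p) = Real.exp (2 * Real.log (3 / ε) * p) := by
    rw [← Real.exp_log (show 0 < 3 / ε by positivity), ← Real.exp_nat_mul, Real.log_exp]
    push_cast
    ring_nf
  have e3 : (6 : ℝ) ≤ Real.exp (5 * p) := by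
    have := Real.add_one_le_exp (5 * (p : ℝ))
    linarith
  rw [e2]
  calc ((2 * p : ℕ) : ℝ) * Real.exp (2 * Real.log (3 / ε) * p) *
        (6 * Real.exp (-(ε ^ 2 * (K - 1) / 144)))
      ≤ Real.exp (2 * p) * Real.exp (2 * Real.log (3 / ε) * p) *
        (Real.exp (5 * p) * Real.exp (-(ε ^ 2 * (K - 1) / 144))) := by gcongr
    _ = Real.exp (2 * p + 2 * Real.log (3 / ε) * p + (5 * p + -(ε ^ 2 * (K - 1) / 144))) := by
        rw [Real.exp_add, Real.exp_add, Real.exp_add]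
    _ ≤ _ := by
        rw [Real.exp_le_exp]
        have : ε ^ 2 ≤ 1 := by nlinarith
        nlinarith

/-- Tail of the upper ratio. -/
theorem upperRatio_tail (hK : 2 ≤ K) (hS : S.PosSemidef)
    (ha : (Matrix.of fun (i : Fin d) (k : Fin K) => a k i).rank ≤ p) (hSp : S.rank ≤ p)
    (hlaw : ∀ k, HasLaw (ξ k) (multivariateGaussian 0 S) P) (hind : iIndepFun ξ P)
    (hKp : 100 * (p : ℝ) ≤ K) {ρ t : ℝ} (hρ : 0 < ρ) (ht : 0 ≤ t) :
    P.real {ω | 8 + t < upperRatio ρ (sampleCov a + S) (noncentralCov a fun k => ξ k ω)} ≤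
      Real.exp (-(1 / 25 * K * t)) := by
  have hP : IsProbabilityMeasure P := hind.isProbabilityMeasure
  refine (measureReal_mono fun ω hω hcon => ?_).trans
    (uniform_upper_tail hK hS ha hSp hlaw hind hKp ht)
  exact (not_le.2 hω) (upperRatio_le ((posSemidef_sampleCov (by omega) a).add hS)
    (posSemidef_sampleCov (by omega) _) hρ (by positivity) hcon)

end RareEvent

end NoncentralCov

/-! ### Choice of constants and conclusion -/

theorem theorem6p1 :
    ∃ Cmom : ℕ → ℝ, (∀ n, 0 < Cmom n) ∧
    ∀ δ : ℝ, 0 < δ →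
    ∃ Dδ cδ : ℝ, 0 < Dδ ∧ 0 < cδ ∧
    ∀ (d K p : ℕ), 2 ≤ K →
    ∀ (a : Fin K → EuclideanSpace ℝ (Fin d)) (S : Matrix (Fin d) (Fin d) ℝ),
      S.PosSemidef →
      (Matrix.of fun (i : Fin d) (k : Fin K) => a k i).rank ≤ p →
      S.rank ≤ p →
    ∀ ρ : ℝ, 0 < ρ →
    ∀ (Ω : Type*) [MeasurableSpace Ω] (P : Measure Ω) [IsProbabilityMeasure P]
      (ξ : Fin K → Ω → EuclideanSpace ℝ (Fin d)),
      (∀ k, HasLaw (ξ k) (multivariateGaussian 0 S) P) →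
      iIndepFun ξ P →
      -- `E Z = D`, entrywise
      (∀ i j : Fin d,
        Integrable (fun ω => NoncentralCov.noncentralCov a (fun k => ξ k ω) i j) P ∧
        ∫ ω, NoncentralCov.noncentralCov a (fun k => ξ k ω) i j ∂P =
          (NoncentralCov.sampleCov a + S) i j) ∧
      (Dδ / cδ * p < K →
        -- the rare event
        P.real (NoncentralCov.rareEvent δ ρ a S ξ) ≤
          (Real.log (NoncentralCov.condNumber
            (NoncentralCov.sampleCov a + ρ • (1 : Matrix (Fin d) (Fin d) ℝ))) + 1) *
            Real.exp (Dδ * p - cδ * K) ∧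
        -- moments of `μ` on the rare event
        (ρ ≤ NoncentralCov.opNorm S → ∀ n : ℕ,
          ∫⁻ ω in NoncentralCov.rareEvent δ ρ a S ξ,
            ENNReal.ofReal (NoncentralCov.inverseRatio ρ (NoncentralCov.sampleCov a + S)
              (NoncentralCov.noncentralCov a fun k => ξ k ω) ^ n) ∂P ≤
          ENNReal.ofReal (Cmom n * (ρ ^ n)⁻¹ * NoncentralCov.opNorm S ^ n *
            (Real.log (NoncentralCov.condNumber
              (NoncentralCov.sampleCov a + ρ • (1 : Matrix (Fin d) (Fin d) ℝ))) + 1) *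
            Real.exp (Dδ * p - cδ * K)))) ∧
      -- the tail of `λ`
      (Dδ * p ≤ K → ∀ t : ℝ, 0 < t →
        P.real {ω | 8 + t < NoncentralCov.upperRatio ρ (NoncentralCov.sampleCov a + S)
            (NoncentralCov.noncentralCov a fun k => ξ k ω)} ≤
          Real.exp (-(cδ * K * t))) := by
  refine ⟨NoncentralCov.momentConst, NoncentralCov.momentConst_pos, fun δ hδ => ?_⟩
  obtain ⟨ε, hε, hε1, hεδ⟩ : ∃ ε : ℝ, 0 < ε ∧ ε ≤ 1 / 16 ∧ 8 * ε ≤ δ :=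
    ⟨min (1 / 16) (δ / 8), lt_min (by norm_num) (by positivity), min_le_left _ _, by
      linarith [min_le_right (1 / 16) (δ / 8)]⟩
  have hlog : 0 ≤ Real.log (3 / ε) := Real.log_nonneg (by
    rw [le_div_iff₀ hε]; linarith)
  have hε2 : ε ^ 2 ≤ 1 := by nlinarith
  refine ⟨100 + 2 * Real.log (3 / ε), ε ^ 2 / 144, by positivity, by positivity, ?_⟩
  intro d K p hK a S hS ha hSp ρ hρ Ω _ P _ ξ hlaw hind
  have hK2 : (2 : ℝ) ≤ K := by exact_mod_cast hK
  refine ⟨NoncentralCov.integral_noncentralCov hK hS hlaw hind a, ?_, ?_⟩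
  · intro hKp
    have hlogC := NoncentralCov.log_condNumber_nonneg (NoncentralCov.posDef_add_smul_one
      (NoncentralCov.posSemidef_sampleCov (by omega : 1 ≤ K) a) hρ).isUnit
    set β := Real.exp ((100 + 2 * Real.log (3 / ε)) * p - ε ^ 2 / 144 * K) with hβ
    -- The assumption on `K` thus gives `100 p / ε² ≤ K`, which yields both `3 ≤ ε (K - 1)` for `p ≥
    -- 1` and `100 p ≤ K`.
    have hratio : 100 / ε ^ 2 ≤ (100 + 2 * Real.log (3 / ε)) / (ε ^ 2 / 144) := by
      rw [div_le_div_iff₀ (by positivity) (by positivity)]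
      nlinarith [mul_nonneg hlog (sq_nonneg ε), sq_nonneg ε]
    have hKp' : 100 / ε ^ 2 * p ≤ K := by
      refine le_trans ?_ hKp.le
      gcongr
    have hrare := NoncentralCov.rareEvent_le hK hS ha hSp hlaw hind hρ hε hε1 hεδ (fun hp => by
      have hp1 : (1 : ℝ) ≤ p := by exact_mod_cast hp
      have h1 : 100 / ε ^ 2 ≤ K := le_trans (le_mul_of_one_le_right (by positivity) hp1) hKp'
      rw [div_le_iff₀ (by positivity)] at h1
      nlinarith)
    have hU : P.real (NoncentralCov.rareEvent δ ρ a S ξ) ≤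
        (Real.log (NoncentralCov.condNumber
            (NoncentralCov.sampleCov a + ρ • (1 : Matrix (Fin d) (Fin d) ℝ))) + 1) * β :=
      hrare.trans (le_mul_of_one_le_left (Real.exp_pos _).le (by linarith))
    refine ⟨hU, fun hρS n => ?_⟩
    have h100 : 100 * (p : ℝ) ≤ K := by
      refine le_trans ?_ hKp'
      gcongr
      rw [le_div_iff₀ (by positivity)]
      linarith
    refine (NoncentralCov.moment_bound hK hS hSp hlaw hind h100 hρ hρS _ hU ?_ n).trans ?_
    · refine le_trans (Real.exp_le_exp.2 ?_)
        (le_mul_of_one_le_left (Real.exp_pos _).le (by linarith))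
      have : 0 ≤ (100 + 2 * Real.log (3 / ε)) * p := by positivity
      nlinarith
    · refine ENNReal.ofReal_le_ofReal (le_of_eq ?_)
      rw [div_pow]
      ring
  · intro hKp t ht
    refine (NoncentralCov.upperRatio_tail hK hS ha hSp hlaw hind ?_ hρ ht.le).trans
      (Real.exp_le_exp.2 ?_)
    · refine le_trans ?_ hKp
      gcongr
      linarith
    · have : ε ^ 2 / 144 * K * t ≤ 1 / 25 * K * t := by
        gcongr
        linarith
      linarith
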